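/- For $\alpha\in(0,\pi)$ let $\mathcal W_\alpha=\{(x_1,x_2,x_3)\in\mathbb R^3:\ |x_2|\le x_1\tan\frac{\alpha}{2}\}$ be the infinite wedge of opening $\alpha$. For a constant magnetic field $\mathbf B=(b_1,b_2,b_3)$ let $E(\mathbf B,\mathcal W_\alpha)$ be the bottom of the spectrum of the magnetic Laplacian $(-i\nabla-\mathbf A)^2$ on $L^2(\mathcal W_\alpha)$ with its natural Neumann boundary condition, i.e. of the self-adjoint operator associated with the quadratic form $u\mapsto\int_{\mathcal W_\alpha}|(-i\nabla-\mathbf A)u|^2\,dx$ on $\{u\in L^2(\mathcal W_\alpha):\ (-i\nabla-\mathbf A)u\in L^2(\mathcal W_\alpha)\}$, where $\mathbf A$ is any linear potential with $\operatorname{curl}\mathbf A=\mathbf B$ (the value does not depend on the choice of $\mathbf A$). For $\tau\in\mathbb R$ let $\zeta(\tau)$ be the first eigenvalue of the operator $-\frac1r\partial_r r\partial_r+(r-\tau)^2$ on $L^2((0,\infty),r\,dr)$, i.e. of the self-adjoint operator associated with the quadratic form $u\mapsto\int_0^\infty\big(|u'(r)|^2+(r-\tau)^2|u(r)|^2\big)\,r\,dr$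 on $\{u:\ u,\ u',\ ru\in L^2((0,\infty),r\,dr)\}$, and let $\Xi_0:=\inf_{\tau\in\mathbb R}\zeta(\tau)$. **Proposition 5.2.** Let $\mathbf B=(b_1,b_2,b_3)\in\mathbb R^3$ with $|\mathbf B|=1$ and $b_2>0$. There exists a constant $C(\mathbf B)>0$ such that $$\forall \alpha\in(0,\pi),\qquad E(\mathbf B,\mathcal W_\alpha)\le b_2\,\Xi_0+C(\mathbf B)\,\alpha^2 .$$ -/

import Mathlib

open MeasureTheory Set
open scoped ContDiff

noncomputable section

namespace WedgeMagnetic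

/-! ### Operators associated with quadratic forms, and their spectrum -/

section Abstract

variable {H K : Type*} [NormedAddCommGroup H] [InnerProductSpace ℂ H]
  [NormedAddCommGroup K] [InnerProductSpace ℂ K]

/-- `D` is (the graph of) a linear map from a subspace of `H` to `K`. It carries the quadratic form
`q u = ‖D u‖²` with form domain `Dom D`. `FormOperator D u f` says that `u` belongs to the domain
of the operator `T` associated with `q` and that `T u = f`, that is: `u ∈ Dom D` and
`⟪D v, D u⟫ = ⟪v, f⟫` for every `v ∈ Dom D`. -/
def FormOperator (D : H → K → Prop) (u f : H) : Prop :=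
  ∃ w : K, D u w ∧ ∀ (v : H) (z : K), D v z → inner ℂ z w = inner ℂ v f

/-- `z` is in the resolvent set of the (unbounded) operator with graph `T`: the operator `T - z`
is a bijection from its domain onto `H` with a bounded inverse `R`.
(`T u (f + z • u)` reads `(T - z) u = f`.) -/
def IsResolventPoint (T : H → H → Prop) (z : ℂ) : Prop :=
  ∃ R : H →L[ℂ] H, ∀ u f : H, T u (f + z • u) ↔ u = R f

/-- The spectrum of the (unbounded) operator with graph `T`. -/
def operatorSpectrum (T : H → H → Prop) : Set ℂ :=
  {z | ¬ IsResolventPoint T z}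

/-- The bottom of the spectrum of a self-adjoint operator (whose spectrum is real), as an infimum
of extended reals. -/
def bottomOfSpectrum (T : H → H → Prop) : EReal :=
  ⨅ (t : ℝ) (_ : (t : ℂ) ∈ operatorSpectrum T), (t : EReal)

/-- `t` is an eigenvalue of the (unbounded) operator with graph `T`. -/
def IsEigenvalue (T : H → H → Prop) (t : ℝ) : Prop :=
  ∃ u : H, u ≠ 0 ∧ T u ((t : ℂ) • u)

/-- The first (lowest) eigenvalue of a self-adjoint operator. -/
def firstEigenvalue (T : H → H → Prop) : EReal :=
  ⨅ (t : ℝ) (_ : IsEigenvalue T t), (t : EReal)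

end Abstract

/-! ### The magnetic Laplacian with natural Neumann condition on an open set of `ℝ³` -/

/-- Euclidean space `ℝ³`; the coordinates `x₁, x₂, x₃` are `x 0, x 1, x 2`. -/
abbrev E3 : Type := EuclideanSpace ℝ (Fin 3)

/-- The partial derivative `∂ⱼ F`. -/
def partialDeriv {G : Type*} [NormedAddCommGroup G] [NormedSpace ℝ G]
    (j : Fin 3) (F : E3 → G) (x : E3) : G :=
  fderiv ℝ F x (EuclideanSpace.single j 1)

/-- The curl of a vector field on `ℝ³`. -/
def curl (A : E3 → E3) (x : E3) : E3 :=
  !₂[partialDeriv 1 A x 2 - partialDeriv 2 A x 1,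
     partialDeriv 2 A x 0 - partialDeriv 0 A x 2,
     partialDeriv 0 A x 1 - partialDeriv 1 A x 0]

/-- The complex Hilbert space `L²(U)`. -/
abbrev L2 (U : Set E3) : Type := Lp ℂ 2 (volume.restrict U)

/-- `w = (-i∇ - A) u` in the sense of distributions on the open set `U`, with `u ∈ L²(U)` and
`w ∈ L²(U)³`: for all test functions `φ ∈ C_c^∞(U)` and all `j`,
`∫_U u (i ∂ⱼφ - Aⱼ φ) = ∫_U wⱼ φ`. -/
def IsMagneticGradient (A : E3 → E3) (U : Set E3) (u : L2 U)
    (w : PiLp 2 (fun _ : Fin 3 => L2 U)) : Prop :=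
  ∀ φ : E3 → ℂ, ContDiff ℝ ∞ φ → HasCompactSupport φ → tsupport φ ⊆ U → ∀ j : Fin 3,
    ∫ x in U, u x * (Complex.I * partialDeriv j φ x - ((A x j : ℝ) : ℂ) * φ x)
      = ∫ x in U, w j x * φ x

/-- The magnetic Laplacian `(-i∇ - A)²` on `U` with natural Neumann boundary condition: the operator
associated with the form `∫_U |(-i∇ - A) u|²` on `{u ∈ L²(U) : (-i∇ - A) u ∈ L²(U)}`. -/
def MagneticLaplacian (A : E3 → E3) (U : Set E3) : L2 U → L2 U → Prop :=
  FormOperator (IsMagneticGradient A U)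

/-- The (interior of the) wedge of opening `α ∈ (0, π)` around the `x₃`-axis. -/
def wedge (α : ℝ) : Set E3 :=
  {x | |x 1| < x 0 * Real.tan (α / 2)}

/-- The ground energy of the magnetic Laplacian with potential `A` on the wedge of opening `α`. -/
def groundEnergy (A : E3 → E3) (α : ℝ) : EReal :=
  bottomOfSpectrum (MagneticLaplacian A (wedge α))

/-! ### The weighted operator on the half-line -/

/-- The measure `r dr` on `(0, ∞)`. -/
def radialMeasure : Measure ℝ :=
  (volume.restrict (Ioi (0 : ℝ))).withDensity (fun r => ENNReal.ofReal r)

/-- The complex Hilbert space `L²((0, ∞), r dr)`. -/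
abbrev L2r : Type := Lp ℂ 2 radialMeasure

/-- `g` is the distributional derivative of `u` on `(0, ∞)`. -/
def IsWeakDeriv (u g : L2r) : Prop :=
  ∀ φ : ℝ → ℂ, ContDiff ℝ ∞ φ → HasCompactSupport φ → tsupport φ ⊆ Ioi (0 : ℝ) →
    ∫ r in Ioi (0 : ℝ), u r * deriv φ r = - ∫ r in Ioi (0 : ℝ), g r * φ r

/-- `w = (u', (r - τ) u)`, with `u`, `u'` and `(r - τ) u` in `L²(r dr)`. As `u ∈ L²(r dr)`, the last
condition is the same as `r u ∈ L²(r dr)`. -/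
def IsRadialGradient (τ : ℝ) (u : L2r) (w : PiLp 2 (fun _ : Fin 2 => L2r)) : Prop :=
  IsWeakDeriv u (w 0) ∧ ∀ᵐ r ∂radialMeasure, w 1 r = ((r - τ : ℝ) : ℂ) * u r

/-- The operator `-(1/r) ∂ᵣ r ∂ᵣ + (r - τ)²` in `L²(r dr)`, associated with the form
`∫ (|u'|² + (r - τ)² |u|²) r dr` on `{u : u, u', r u ∈ L²(r dr)}`. -/
def RadialOperator (τ : ℝ) : L2r → L2r → Prop :=
  FormOperator (IsRadialGradient τ)

/-- `ζ(τ)`, the first eigenvalue. -/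
def zeta (τ : ℝ) : EReal := firstEigenvalue (RadialOperator τ)

/-- `Ξ₀ = inf_τ ζ(τ)`. -/
def Xi0 : EReal := ⨅ τ : ℝ, zeta τ

end WedgeMagnetic

end

/-! A trial function gives the bound. In the gauge `A = (-b₃ x₂, 0, b₁ x₂ - b₂ x₁ + √b₂ τ)` take `f
(√b₂ x₁) χ (x₃)` with `f` real and `χ` a cut-off of negligible energy. Integrating over `|x₂| < x₁
tan (α/2)` produces the weight `2 x₁ tan (α/2)`, so the leading part is `b₂` times the Rayleigh
quotient of `f` for the radial form with parameter `τ`. The term linear in `x₂` vanishes by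
symmetry, and the quadratic term contributes `(b₁² + b₃²) tan² (α/2) / (3 b₂)` times the normalised
moment of `r²`. This is `groundEnergy_le_radial`. It rests on the min-max bound
`bottomOfSpectrum_le_rayleigh`, where `(T + 1)⁻¹ = J J*` for the projection `J` of the closed graph
to its first factor.

The constant must not depend on how closely `τ` and `f` approach `Ξ₀`, so the moment has to be
bounded uniformly. An explicit `f₀` has radial quotient at most `23 / 25`. Eigenvalues above this
threshold are beaten by `f₀`. Below it, `radial_lower_bound` excludes `τ ≥ 30`, where the form is
nearly a Landau level with bottom close to `1`, and negative `τ ≤ -1` is excluded since then `(r -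
τ)² ≥ 1`. Bounded `τ` and bounded energy bound the moment (`radial_moment_le`).

Passing from an eigenvalue to a `C¹` trial function uses the density of `C¹` functions vanishing for
large `r` in the form domain (`mem_closure_radialCore`), which follows from a Hardy inequality for
primitives with weight `r dr`.

For `α ≤ 2`, `tan (α/2) ≤ α`. For `α ≥ 2` the tangent is unbounded, but all these wedges contain one
fixed ball, and a bump in it bounds the energy by a constant, which is at most a multiple of `α²`.
-/

noncomputable section

namespace WedgeMagnetic

/-! ### Variational principle for the operator of a closed form -/

section Abstract

variable {H K : Type*} [NormedAddCommGroup H] [InnerProductSpace ℂ H]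
  [NormedAddCommGroup K] [InnerProductSpace ℂ K]

/-- The projection of a graph to its first component. -/
def graphFst (G : Submodule ℂ (WithLp 2 (H × K))) : G →L[ℂ] H :=
  (WithLp.fstL 2 ℂ H K).comp G.subtypeL

lemma graphFst_apply (G : Submodule ℂ (WithLp 2 (H × K))) (x : G) :
    graphFst G x = (x : WithLp 2 (H × K)).fst := rfl

/-- Resolvent identity: a resolvent point `t ≠ -1` of `T` yields the resolvent point `1 / (1 + t)`
of `(T + 1)⁻¹`. -/
lemma isUnit_algebraMap_sub_of_isResolventPoint {T : H → H → Prop} {R : H →L[ℂ] H}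
    (hR : ∀ u f, T u (f - u) ↔ u = R f) {t : ℂ} (ht : 1 + t ≠ 0) (h : IsResolventPoint T t) :
    IsUnit (algebraMap ℂ (H →L[ℂ] H) (1 + t)⁻¹ - R) := by
  obtain ⟨S, hS⟩ := h
  have h1 : ∀ f, S f = R f + (1 + t) • R (S f) := fun f => by
    have := (hS (S f) f).2 rfl
    have h2 : f + t • S f = (f + (1 + t) • S f) - S f := by module
    rw [h2, hR] at this
    simpa using this
  have h2 : ∀ f, R f = S f - (1 + t) • S (R f) := fun f => by
    have := (hR (R f) f).2 rfl
    have h2 : f - R f = (f - (1 + t) • R f) + t • R f := by module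
    rw [h2, hS] at this
    simpa using this
  -- With `c = 1 + t`, the inverse of `c⁻¹ - R` is `c (1 + c S)`: the product is `1 + c (S - R - c R
  -- S)`, and the resolvent identity makes the bracket zero.
  refine ⟨⟨algebraMap ℂ (H →L[ℂ] H) (1 + t)⁻¹ - R, (1 + t) • (1 + (1 + t) • S), ?_, ?_⟩, rfl⟩
  · ext f
    have h3 := h1 f
    simp only [mul_apply_eq_comp, sub_apply, smul_apply, add_apply, one_apply_eq_self,
      Algebra.algebraMap_eq_smul_one, map_smul, map_add, smul_sub, smul_add, smul_smul, mul_assoc,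
      mul_inv_cancel₀ ht, mul_one, one_smul]
    linear_combination (norm := module) (1 + t) • h3
  · ext f
    have h3 := h2 f
    simp only [mul_apply_eq_comp, sub_apply, smul_apply, add_apply, one_apply_eq_self,
      Algebra.algebraMap_eq_smul_one, map_smul, map_sub, smul_add, smul_smul,
      inv_mul_cancel₀ ht, inv_mul_cancel_left₀ ht, one_smul]
    linear_combination (norm := module) (-(1 + t)) • h3

variable [CompleteSpace H]

/-- The equation `(T + 1) u = f` says `⟪v, u⟫ + ⟪D v, D u⟫ = ⟪v, f⟫` for all `v`. The left side is
the inner product of the graph, so `(u, D u)` is the Riesz representative `J* f`, and `(T + 1)⁻¹ = J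
J*`. -/
lemma formOperator_sub_iff {D : H → K → Prop} (G : Submodule ℂ (WithLp 2 (H × K)))
    [CompleteSpace G] (hG : ∀ u w, D u w ↔ WithLp.toLp 2 (u, w) ∈ G) (u f : H) :
    FormOperator D u (f - u) ↔
      u = (graphFst G ∘L ContinuousLinearMap.adjoint (graphFst G)) f := by
  set J := graphFst G with hJ
  constructor
  · rintro ⟨w, hw, h⟩
    have hx : (⟨WithLp.toLp 2 (u, w), (hG u w).1 hw⟩ : G) = ContinuousLinearMap.adjoint J f := by
      refine ext_inner_left ℂ fun y => ?_
      rw [ContinuousLinearMap.adjoint_inner_right, Submodule.coe_inner,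
        WithLp.prod_inner_apply, hJ, graphFst_apply]
      have := h (y : WithLp 2 (H × K)).fst (y : WithLp 2 (H × K)).snd ((hG _ _).2 y.2)
      change inner ℂ (y : WithLp 2 (H × K)).fst u + inner ℂ (y : WithLp 2 (H × K)).snd w = _
      rw [this, inner_sub_right]
      ring
    rw [ContinuousLinearMap.comp_apply, ← hx]
    rfl
  · intro hu
    set x := ContinuousLinearMap.adjoint J f with hx
    have hu' : u = (x : WithLp 2 (H × K)).fst := hu
    refine ⟨(x : WithLp 2 (H × K)).snd, ?_, fun v z hv => ?_⟩
    · rw [hG, hu']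
      exact x.2
    · have h1 : inner ℂ (⟨WithLp.toLp 2 (v, z), (hG v z).1 hv⟩ : G) x = inner ℂ v f := by
        rw [hx, ContinuousLinearMap.adjoint_inner_right]
        rfl
      rw [Submodule.coe_inner, WithLp.prod_inner_apply] at h1
      change inner ℂ v (x : WithLp 2 (H × K)).fst + inner ℂ z (x : WithLp 2 (H × K)).snd = _ at h1
      rw [inner_sub_right, ← h1, hu']
      ring

/-- The variational upper bound for the bottom of the spectrum of the operator associated with a
closed quadratic form. -/
theorem bottomOfSpectrum_le_rayleigh [CompleteSpace K] {D : H → K → Prop}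
    (G : Submodule ℂ (WithLp 2 (H × K))) (hGc : IsClosed (G : Set (WithLp 2 (H × K))))
    (hG : ∀ u w, D u w ↔ WithLp.toLp 2 (u, w) ∈ G) {u : H} {w : K} (hu : u ≠ 0) (huw : D u w) :
    bottomOfSpectrum (FormOperator D) ≤ ((‖w‖ ^ 2 / ‖u‖ ^ 2 : ℝ) : EReal) := by
  have : CompleteSpace G := hGc.completeSpace_coe
  set J := graphFst G with hJ
  set R := J ∘L ContinuousLinearMap.adjoint J with hRdef
  have hR : ∀ u f, FormOperator D u (f - u) ↔ u = R f := formOperator_sub_iff G hG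
  have hRpos : 0 ≤ R := by
    rw [ContinuousLinearMap.nonneg_iff_isPositive]
    exact ContinuousLinearMap.isPositive_self_comp_adjoint J
  have hRn : ‖R‖ = ‖J‖ * ‖J‖ := by
    have := ContinuousLinearMap.norm_adjoint_comp_self (ContinuousLinearMap.adjoint J)
    rw [ContinuousLinearMap.adjoint_adjoint, LinearIsometryEquiv.norm_map] at this
    exact this
  set x : G := ⟨WithLp.toLp 2 (u, w), (hG u w).1 huw⟩
  have hxn : ‖x‖ ^ 2 = ‖u‖ ^ 2 + ‖w‖ ^ 2 := by
    have : ‖x‖ = ‖(WithLp.toLp 2 (u, w) : WithLp 2 (H × K))‖ := rfl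
    rw [this, WithLp.prod_norm_sq_eq_of_L2]
    rfl
  have hu0 : 0 < ‖u‖ := norm_pos_iff.2 hu
  -- Since `‖R‖ = ‖J‖²`, testing `J` on the single vector `(u, w)` bounds `‖R‖` from below.
  have hle : ‖u‖ ^ 2 ≤ ‖R‖ * (‖u‖ ^ 2 + ‖w‖ ^ 2) := by
    have h1 : ‖u‖ ≤ ‖J‖ * ‖x‖ := J.le_opNorm x
    calc ‖u‖ ^ 2 ≤ (‖J‖ * ‖x‖) ^ 2 := by gcongr
      _ = _ := by rw [hRn, ← hxn]; ring
  have hRp : 0 < ‖R‖ := by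
    by_contra hneg
    have : ‖R‖ = 0 := le_antisymm (not_lt.1 hneg) (norm_nonneg _)
    rw [this, zero_mul] at hle
    nlinarith
  have : Nontrivial H := ⟨u, 0, hu⟩
  -- The norm of a positive element of a C⋆-algebra lies in its spectrum. Pulled back by the
  -- resolvent identity, this puts `‖R‖⁻¹ - 1` in the spectrum of the form operator.
  have hmem : ‖R‖ ∈ spectrum ℝ R := CStarAlgebra.norm_mem_spectrum_of_nonneg hRpos
  have hmemC : ((‖R‖ : ℝ) : ℂ) ∈ spectrum ℂ R := spectrum.algebraMap_mem ℂ hmem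
  have hspec : ((‖R‖⁻¹ - 1 : ℝ) : ℂ) ∈ operatorSpectrum (FormOperator D) := by
    intro hres
    have h1 : (1 : ℂ) + ((‖R‖⁻¹ - 1 : ℝ) : ℂ) = ((‖R‖ : ℝ) : ℂ)⁻¹ := by push_cast; ring
    have h2 := isUnit_algebraMap_sub_of_isResolventPoint hR
      (by rw [h1]; exact inv_ne_zero (by exact_mod_cast hRp.ne')) hres
    rw [h1, inv_inv] at h2
    exact hmemC h2
  refine (iInf₂_le (f := fun (t : ℝ) (_ : (t : ℂ) ∈ operatorSpectrum (FormOperator D)) =>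
    (t : EReal)) _ hspec).trans ?_
  rw [EReal.coe_le_coe_iff, le_div_iff₀ (by positivity)]
  have : ‖R‖⁻¹ * ‖u‖ ^ 2 ≤ ‖u‖ ^ 2 + ‖w‖ ^ 2 := by
    rw [inv_mul_le_iff₀ hRp]
    exact hle
  linarith

end Abstract

/-! ### The closed magnetic gradient and classical trial functions -/

section General

variable {X : Type*} [MeasurableSpace X] {μ : Measure X}

lemma exists_clm_eq_integral_mul {a : X → ℂ} (ha : MemLp a 2 μ) :
    ∃ l : Lp ℂ 2 μ →L[ℂ] ℂ, ∀ u, l u = ∫ x, u x * a x ∂μ := by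
  have ha' : MemLp (fun x => starRingEnd ℂ (a x)) 2 μ := ha.star
  refine ⟨innerSL ℂ (ha'.toLp _), fun u => ?_⟩
  rw [innerSL_apply_apply, L2.inner_def]
  refine integral_congr_ae ?_
  filter_upwards [ha'.coeFn_toLp] with x hx
  rw [hx, RCLike.inner_apply]
  simp

lemma norm_toLp_sq {f : X → ℂ} (hf : MemLp f 2 μ) :
    ‖hf.toLp f‖ ^ 2 = ∫ x, ‖f x‖ ^ 2 ∂μ := by
  rw [← @inner_self_eq_norm_sq ℂ, L2.inner_def, ← integral_re]
  · refine integral_congr_ae ?_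
    filter_upwards [hf.coeFn_toLp] with x hx
    rw [hx, inner_self_eq_norm_sq]
  · exact L2.integrable_inner _ _

end General

lemma memLp_restrict_of_continuous {U K : Set E3} (hU : MeasurableSet U) (hK : IsCompact K)
    {F : E3 → ℂ} (hF : Continuous F) (h0 : ∀ x ∈ U \ K, F x = 0) :
    MemLp F 2 (volume.restrict U) := by
  have h1 : MemLp F 2 (volume.restrict K) := by
    obtain ⟨C, hC⟩ := hK.exists_bound_of_continuousOn hF.continuousOn
    have : IsFiniteMeasure (volume.restrict K) :=
      ⟨by rw [Measure.restrict_apply_univ]; exact hK.measure_lt_top⟩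
    refine MemLp.of_bound hF.aestronglyMeasurable C ?_
    exact (ae_restrict_iff' hK.measurableSet).2 (Filter.Eventually.of_forall hC)
  have h2 : MemLp (K.indicator F) 2 (volume.restrict U) :=
    ((memLp_indicator_iff_restrict hK.measurableSet).2 h1).restrict U
  refine h2.ae_eq ?_
  refine (ae_restrict_iff' hU).2 (Filter.Eventually.of_forall fun x hx => ?_)
  by_cases hxK : x ∈ K
  · rw [indicator_of_mem hxK]
  · rw [indicator_of_notMem hxK, h0 x ⟨hx, hxK⟩]

lemma memLp_of_hasCompactSupport {U : Set E3} {F : E3 → ℂ}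
    (hF : Continuous F) (hc : HasCompactSupport F) : MemLp F 2 (volume.restrict U) :=
  (hF.memLp_of_hasCompactSupport hc).restrict U

lemma continuous_partialDeriv {φ : E3 → ℂ} (hφ : ContDiff ℝ 1 φ) (j : Fin 3) :
    Continuous (partialDeriv j φ) :=
  (hφ.continuous_fderiv one_ne_zero).clm_apply continuous_const

lemma hasCompactSupport_partialDeriv {φ : E3 → ℂ} (hφ : HasCompactSupport φ) (j : Fin 3) :
    HasCompactSupport (partialDeriv j φ) :=
  hφ.fderiv_apply (𝕜 := ℝ) _

lemma continuous_coord (j : Fin 3) : Continuous fun x : E3 => x j :=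
  (EuclideanSpace.proj (𝕜 := ℝ) j).continuous

/-- The graph of the magnetic gradient is a closed subspace. -/
lemma exists_closed_graph_isMagneticGradient {A : E3 → E3} (hA : Continuous A) (U : Set E3) :
    ∃ G : Submodule ℂ (WithLp 2 (L2 U × PiLp 2 (fun _ : Fin 3 => L2 U))),
      IsClosed (G : Set (WithLp 2 (L2 U × PiLp 2 (fun _ : Fin 3 => L2 U)))) ∧
      ∀ u w, IsMagneticGradient A U u w ↔ WithLp.toLp 2 (u, w) ∈ G := by
  let I := {φ : E3 → ℂ // ContDiff ℝ ∞ φ ∧ HasCompactSupport φ ∧ tsupport φ ⊆ U} × Fin 3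
  have hm1 : ∀ i : I, MemLp (fun x => Complex.I * partialDeriv i.2 i.1.1 x
      - ((A x i.2 : ℝ) : ℂ) * i.1.1 x) 2 (volume.restrict U) := fun i => by
    refine memLp_of_hasCompactSupport ?_ ?_
    · have h1 : Continuous fun x => A x i.2 := (continuous_coord _).comp hA
      exact (continuous_const.mul (continuous_partialDeriv (i.1.2.1.of_le (by simp)) _)).sub
        ((Complex.continuous_ofReal.comp h1).mul i.1.2.1.continuous)
    · exact ((hasCompactSupport_partialDeriv i.1.2.2.1 _).mul_left).sub i.1.2.2.1.mul_left
  have hm2 : ∀ i : I, MemLp i.1.1 2 (volume.restrict U) := fun i =>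
    memLp_of_hasCompactSupport i.1.2.1.continuous i.1.2.2.1
  choose l1 hl1 using fun i => exists_clm_eq_integral_mul (hm1 i)
  choose l2 hl2 using fun i => exists_clm_eq_integral_mul (hm2 i)
  let l : I → WithLp 2 (L2 U × PiLp 2 (fun _ : Fin 3 => L2 U)) →L[ℂ] ℂ := fun i =>
    (l1 i).comp (WithLp.fstL 2 ℂ _ _) -
      ((l2 i).comp (PiLp.proj (𝕜 := ℂ) 2 (fun _ : Fin 3 => L2 U) i.2)).comp (WithLp.sndL 2 ℂ _ _)
  -- Each test function and each coordinate impose one continuous linear condition on `(u, w)`. The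
  -- graph is the intersection of the kernels.
  refine ⟨⨅ i, (l i).ker, ?_, fun u w => ?_⟩
  · rw [Submodule.coe_iInf]
    exact isClosed_iInter fun i => (l i).isClosed_ker
  · rw [Submodule.mem_iInf]
    have key : ∀ i : I, WithLp.toLp 2 (u, w) ∈ (l i).ker ↔
        l1 i u = l2 i (w i.2) := fun i => by
      rw [LinearMap.mem_ker]
      exact sub_eq_zero
    constructor
    · intro h i
      rw [key, hl1, hl2]
      exact h i.1.1 i.1.2.1 i.1.2.2.1 i.1.2.2.2 i.2
    · intro h φ h1 h2 h3 j
      have := (key ⟨⟨φ, h1, h2, h3⟩, j⟩).1 (h _)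
      rwa [hl1, hl2] at this

/-- A `C¹` function with square integrable classical magnetic gradient lies in the form domain. -/
lemma isMagneticGradient_toLp {A : E3 → E3} (hA : Continuous A) {U : Set E3}
    {ψ : E3 → ℂ} (hψ : ContDiff ℝ 1 ψ) (h0 : MemLp ψ 2 (volume.restrict U))
    (h1 : ∀ j, MemLp (fun x => -Complex.I * partialDeriv j ψ x - ((A x j : ℝ) : ℂ) * ψ x) 2
      (volume.restrict U)) :
    IsMagneticGradient A U (h0.toLp ψ) (WithLp.toLp 2 fun j => (h1 j).toLp _) := by
  intro φ hφ hc hs j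
  have hφU : ∀ x, x ∉ U → φ x = 0 := fun x hx => image_eq_zero_of_notMem_tsupport fun h => hx (hs h)
  have hφU' : ∀ x, x ∉ U → partialDeriv j φ x = 0 := fun x hx => by
    have : fderiv ℝ φ x = 0 :=
      image_eq_zero_of_notMem_tsupport fun h => hx (hs (tsupport_fderiv_subset ℝ h))
    rw [partialDeriv, this]
    rfl
  have hA' : Continuous fun x => ((A x j : ℝ) : ℂ) :=
    Complex.continuous_ofReal.comp ((continuous_coord _).comp hA)
  have hφ1 : ContDiff ℝ 1 φ := hφ.of_le (by simp)
  have hdφ := continuous_partialDeriv hφ1 j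
  have hdψ := continuous_partialDeriv hψ j
  have hcd := hasCompactSupport_partialDeriv hc j
  have e1 : ∫ x in U, (h0.toLp ψ) x * (Complex.I * partialDeriv j φ x - ((A x j : ℝ) : ℂ) * φ x)
      = ∫ x, ψ x * (Complex.I * partialDeriv j φ x - ((A x j : ℝ) : ℂ) * φ x) := by
    rw [← setIntegral_eq_integral_of_forall_compl_eq_zero (s := U)
      (f := fun x => ψ x * (Complex.I * partialDeriv j φ x - ((A x j : ℝ) : ℂ) * φ x))]
    · refine integral_congr_ae ?_
      filter_upwards [h0.coeFn_toLp] with x hx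
      rw [hx]
    · intro x hx
      rw [hφU x hx, hφU' x hx]
      simp
  have e2 : ∫ x in U, (h1 j).toLp _ x * φ x
      = ∫ x, (-Complex.I * partialDeriv j ψ x - ((A x j : ℝ) : ℂ) * ψ x) * φ x := by
    rw [← setIntegral_eq_integral_of_forall_compl_eq_zero (s := U)
      (f := fun x => (-Complex.I * partialDeriv j ψ x - ((A x j : ℝ) : ℂ) * ψ x) * φ x)]
    · refine integral_congr_ae ?_
      filter_upwards [(h1 j).coeFn_toLp] with x hx
      rw [hx]
    · intro x hx
      rw [hφU x hx]
      simp
  have i1 : Integrable (fun x => partialDeriv j ψ x * φ x) :=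
    (hdψ.mul hφ1.continuous).integrable_of_hasCompactSupport hc.mul_left
  have i2 : Integrable (fun x => ψ x * partialDeriv j φ x) :=
    (hψ.continuous.mul hdφ).integrable_of_hasCompactSupport hcd.mul_left
  have i3 : Integrable (fun x => ψ x * φ x) :=
    (hψ.continuous.mul hφ1.continuous).integrable_of_hasCompactSupport hc.mul_left
  have i4 : Integrable (fun x => ((A x j : ℝ) : ℂ) * ψ x * φ x) :=
    ((hA'.mul hψ.continuous).mul hφ1.continuous).integrable_of_hasCompactSupport hc.mul_left
  -- The test function vanishes off `U`, so the integration by parts takes place on all of `ℝ³`. No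
  -- boundary term appears and `ψ` needs no boundary condition.
  have ibp : ∫ x, ψ x * partialDeriv j φ x = - ∫ x, partialDeriv j ψ x * φ x :=
    integral_mul_fderiv_eq_neg_fderiv_mul_of_integrable i1 i2 i3
      (fun x _ => hψ.differentiable one_ne_zero x) (fun x _ => hφ1.differentiable one_ne_zero x)
  change ∫ x in U, (h0.toLp ψ) x * _ = ∫ x in U, (h1 j).toLp _ x * φ x
  rw [e1, e2]
  have e3 : ∀ x, ψ x * (Complex.I * partialDeriv j φ x - ((A x j : ℝ) : ℂ) * φ x)
      = Complex.I * (ψ x * partialDeriv j φ x) - ((A x j : ℝ) : ℂ) * ψ x * φ x := fun x => by ring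
  have e4 : ∀ x, (-Complex.I * partialDeriv j ψ x - ((A x j : ℝ) : ℂ) * ψ x) * φ x
      = -Complex.I * (partialDeriv j ψ x * φ x) - ((A x j : ℝ) : ℂ) * ψ x * φ x := fun x => by ring
  simp_rw [e3, e4]
  rw [integral_sub (i2.const_mul _) i4, integral_sub (i1.const_mul _) i4, integral_const_mul,
    integral_const_mul, ibp]
  ring

lemma isOpen_wedge (α : ℝ) : IsOpen (wedge α) :=
  isOpen_lt (continuous_coord 1).abs ((continuous_coord 0).mul continuous_const)

/-- Variational upper bound for the ground energy by a classical trial function. -/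
lemma groundEnergy_le_of_trial {A : E3 → E3} (hA : Continuous A) {α : ℝ}
    {ψ : E3 → ℂ} (hψ : ContDiff ℝ 1 ψ) {K : Set E3} (hK : IsCompact K)
    (h0 : ∀ x ∈ wedge α \ K, ψ x = 0) (hpos : 0 < ∫ x in wedge α, ‖ψ x‖ ^ 2) :
    groundEnergy A α ≤ (((∫ x in wedge α,
      ∑ j, ‖-Complex.I * partialDeriv j ψ x - ((A x j : ℝ) : ℂ) * ψ x‖ ^ 2)
        / ∫ x in wedge α, ‖ψ x‖ ^ 2 : ℝ) : EReal) := by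
  have hU := isOpen_wedge α
  have hA' : ∀ j, Continuous fun x => ((A x j : ℝ) : ℂ) := fun j =>
    Complex.continuous_ofReal.comp ((continuous_coord _).comp hA)
  have hd0 : ∀ j, ∀ x ∈ wedge α \ K, partialDeriv j ψ x = 0 := fun j x hx => by
    have : ψ =ᶠ[nhds x] fun _ => 0 := by
      filter_upwards [(hU.sdiff hK.isClosed).mem_nhds hx] with y hy using h0 y hy
    rw [partialDeriv, this.fderiv_eq]
    simp
  have m0 := memLp_restrict_of_continuous hU.measurableSet hK hψ.continuous h0
  have m1 : ∀ j, MemLp (fun x => -Complex.I * partialDeriv j ψ x - ((A x j : ℝ) : ℂ) * ψ x) 2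
      (volume.restrict (wedge α)) := fun j => by
    refine memLp_restrict_of_continuous hU.measurableSet hK ?_ fun x hx => ?_
    · exact (continuous_const.mul (continuous_partialDeriv hψ j)).sub
        ((hA' j).mul hψ.continuous)
    · rw [hd0 j x hx, h0 x hx]
      simp
  obtain ⟨G, hGc, hG⟩ := exists_closed_graph_isMagneticGradient hA (wedge α)
  have hn := norm_toLp_sq m0
  have hne : m0.toLp ψ ≠ 0 := by
    intro h
    rw [h, norm_zero] at hn
    rw [← hn] at hpos
    norm_num at hpos
  have := bottomOfSpectrum_le_rayleigh G hGc hG hne (isMagneticGradient_toLp hA hψ m0 m1)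
  rw [hn, PiLp.norm_sq_eq_of_L2] at this
  rw [integral_finsetSum]
  · simp_rw [← norm_toLp_sq (m1 _)]
    exact this
  · intro j _
    exact (m1 j).integrable_norm_pow two_ne_zero

/-! ### Gauge fixing and real trial functions -/

lemma hasFDerivAt_coord (j : Fin 3) (x : E3) :
    HasFDerivAt (fun y : E3 => y j) (EuclideanSpace.proj (𝕜 := ℝ) j) x :=
  (EuclideanSpace.proj (𝕜 := ℝ) j).hasFDerivAt

lemma contDiff_coord {n : WithTop ℕ∞} (j : Fin 3) : ContDiff ℝ n fun y : E3 => y j :=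
  (EuclideanSpace.proj (𝕜 := ℝ) j).contDiff

/-- The reference potential with field `B`, up to a constant `k` in its last component. -/
def refPotential (B : E3) (k : ℝ) (x : E3) : E3 :=
  !₂[-(B 2) * x 1, 0, B 0 * x 1 - B 1 * x 0 - k]

lemma clm_apply_eq_sum (A : E3 →L[ℝ] E3) (x : E3) (j : Fin 3) :
    A x j = A (EuclideanSpace.single 0 1) j * x 0 + A (EuclideanSpace.single 1 1) j * x 1
      + A (EuclideanSpace.single 2 1) j * x 2 := by
  have hx : x = x 0 • EuclideanSpace.single 0 (1 : ℝ) + x 1 • EuclideanSpace.single 1 (1 : ℝ)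
      + x 2 • EuclideanSpace.single 2 (1 : ℝ) := by
    ext i
    fin_cases i <;> simp
  conv_lhs => rw [hx]
  simp only [map_add, map_smul, PiLp.add_apply, PiLp.smul_apply, smul_eq_mul]
  ring

/-- Two linear potentials with the same field differ by a gradient. -/
lemma exists_gauge {A : E3 →L[ℝ] E3} {B : E3} (hA : ∀ x, curl A x = B) (k : ℝ) :
    ∃ θ : E3 → ℝ, ContDiff ℝ 1 θ ∧
      ∀ x j, partialDeriv j θ x = A x j - refPotential B k x j := by
  set a : Fin 3 → Fin 3 → ℝ := fun i j => A (EuclideanSpace.single i 1) j with ha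
  have hp : ∀ i j, partialDeriv i (A : E3 → E3) 0 j = a i j := fun i j => by
    rw [partialDeriv, A.fderiv]
  have h0 : a 1 2 - a 2 1 = B 0 := by
    rw [← hA 0, ← hp, ← hp]; simp [curl]
  have h1 : a 2 0 - a 0 2 = B 1 := by
    rw [← hA 0, ← hp, ← hp]; simp [curl]
  have h2 : a 0 1 - a 1 0 = B 2 := by
    rw [← hA 0, ← hp, ← hp]; simp [curl]
  -- The mixed coefficients are the entries of `A` at the places where the reference potential has
  -- none: the dependence on `x 2`, and the component `1`. The three curl relations take care of the
  -- transposed entries, and `k * x 2` accounts for the constant.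
  let θ : E3 → ℝ := fun x => a 0 0 / 2 * (x 0 * x 0) + a 1 1 / 2 * (x 1 * x 1)
    + a 2 2 / 2 * (x 2 * x 2) + a 0 1 * (x 0 * x 1) + a 2 0 * (x 0 * x 2) + a 2 1 * (x 1 * x 2)
    + k * x 2
  refine ⟨θ, ?_, fun x j => ?_⟩
  · have c := fun j => contDiff_coord (n := 1) j
    have q := fun (r : ℝ) i j => (contDiff_const (c := r)).mul ((c i).mul (c j))
    exact ((((((q _ 0 0).add (q _ 1 1)).add (q _ 2 2)).add (q _ 0 1)).add (q _ 0 2)).add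
      (q _ 1 2)).add (contDiff_const.mul (c 2))
  · have c := fun j => hasFDerivAt_coord j x
    have hd := (((((((c 0).mul (c 0)).const_mul (a 0 0 / 2)).add
      (((c 1).mul (c 1)).const_mul (a 1 1 / 2))).add
      (((c 2).mul (c 2)).const_mul (a 2 2 / 2))).add (((c 0).mul (c 1)).const_mul (a 0 1))).add
      (((c 0).mul (c 2)).const_mul (a 2 0))).add (((c 1).mul (c 2)).const_mul (a 2 1)) |>.add
      ((c 2).const_mul k)
    rw [partialDeriv, HasFDerivAt.fderiv (f := θ) hd, clm_apply_eq_sum A]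
    change _ = a 0 j * x 0 + a 1 j * x 1 + a 2 j * x 2 - _
    fin_cases j <;> simp [refPotential]
    · linear_combination (x 1) * h2
    · ring
    · linear_combination (-x 1) * h0 + (x 0) * h1

/-- For a real amplitude the derivative part is purely imaginary and the potential part real, up to
a common phase. Hence the magnetic energy density has no cross term. -/
lemma normSq_aux (z : ℂ) (hz : ‖z‖ = 1) (p q : ℝ) :
    ‖z * (-Complex.I * p + q)‖ ^ 2 = p ^ 2 + q ^ 2 := by
  rw [norm_mul, hz, one_mul, ← Complex.normSq_eq_norm_sq, Complex.normSq_apply]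
  simp
  ring

/-- Variational upper bound for the ground energy by a real trial function, in the reference
gauge. -/
lemma groundEnergy_le_of_real_trial {A : E3 →L[ℝ] E3} {B : E3} (hA : ∀ x, curl A x = B) (k : ℝ)
    {α : ℝ} {g : E3 → ℝ} (hg : ContDiff ℝ 1 g) {K : Set E3} (hK : IsCompact K)
    (h0 : ∀ x ∈ wedge α \ K, g x = 0) (hpos : 0 < ∫ x in wedge α, g x ^ 2) :
    groundEnergy A α ≤ (((∫ x in wedge α, ∑ j, (partialDeriv j g x ^ 2
      + (refPotential B k x j) ^ 2 * g x ^ 2)) / ∫ x in wedge α, g x ^ 2 : ℝ) : EReal) := by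
  obtain ⟨θ, hθ, hdθ⟩ := exists_gauge hA k
  let e : E3 → ℂ := fun x => Complex.exp ((θ x : ℂ) * Complex.I)
  have he : ∀ x, ‖e x‖ = 1 := fun x => Complex.norm_exp_ofReal_mul_I _
  let ψ : E3 → ℂ := fun x => e x * (g x : ℂ)
  have hθC : ContDiff ℝ 1 fun x => (θ x : ℂ) := Complex.ofRealCLM.contDiff.comp hθ
  have hgC : ContDiff ℝ 1 fun x => (g x : ℂ) := Complex.ofRealCLM.contDiff.comp hg
  have hψ : ContDiff ℝ 1 ψ := ((hθC.mul contDiff_const).cexp).mul hgC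
  have hn : ∀ x, ‖ψ x‖ ^ 2 = g x ^ 2 := fun x => by
    simp only [ψ, norm_mul, he, one_mul, Complex.norm_real, Real.norm_eq_abs, sq_abs]
  have hdψ : ∀ j x, partialDeriv j ψ x
      = e x * (Complex.I * (partialDeriv j θ x : ℝ) * g x + (partialDeriv j g x : ℝ)) := by
    intro j x
    have h1 : HasFDerivAt (fun x => (θ x : ℂ)) (Complex.ofRealCLM.comp (fderiv ℝ θ x)) x :=
      Complex.ofRealCLM.hasFDerivAt.comp x (hθ.differentiable one_ne_zero x).hasFDerivAt
    have h2 : HasFDerivAt (fun x => (g x : ℂ)) (Complex.ofRealCLM.comp (fderiv ℝ g x)) x :=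
      Complex.ofRealCLM.hasFDerivAt.comp x (hg.differentiable one_ne_zero x).hasFDerivAt
    have h3 := ((h1.mul_const Complex.I).cexp).mul h2
    rw [partialDeriv, HasFDerivAt.fderiv (f := ψ) h3]
    simp only [partialDeriv, e, add_apply, smul_apply, ContinuousLinearMap.comp_apply,
      Complex.ofRealCLM_apply, smul_eq_mul]
    ring
  have hw : ∀ j x, ‖-Complex.I * partialDeriv j ψ x - ((A x j : ℝ) : ℂ) * ψ x‖ ^ 2
      = partialDeriv j g x ^ 2 + (refPotential B k x j) ^ 2 * g x ^ 2 := by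
    intro j x
    have : -Complex.I * partialDeriv j ψ x - ((A x j : ℝ) : ℂ) * ψ x
        = e x * (-Complex.I * ((partialDeriv j g x : ℝ) : ℂ)
          + ((-(refPotential B k x j) * g x : ℝ) : ℂ)) := by
      rw [hdψ, hdθ]
      simp only [ψ]
      push_cast
      linear_combination (-e x * ((A x j : ℂ) - (refPotential B k x j : ℂ)) * g x) * Complex.I_sq
    rw [this, normSq_aux _ (he x)]
    ring
  have := groundEnergy_le_of_trial A.continuous hψ hK (α := α)
    (fun x hx => by simp [ψ, h0 x hx]) (by simpa only [hn] using hpos)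
  simpa only [hn, hw] using this

/-! ### Integration over the wedge -/

/-- The coordinates of `ℝ³`, grouped as `(x₃, (x₁, x₂))`. -/
def coordEquiv : E3 ≃ᵐ ℝ × (ℝ × ℝ) :=
  (MeasurableEquiv.toLp 2 (Fin 3 → ℝ)).symm.trans
    ((MeasurableEquiv.piFinSuccAbove (fun _ : Fin 3 => ℝ) 2).trans
      (MeasurableEquiv.prodCongr (MeasurableEquiv.refl ℝ) MeasurableEquiv.finTwoArrow))

lemma coordEquiv_apply (x : E3) : coordEquiv x = (x 2, (x 0, x 1)) := rfl

lemma volume_preserving_coordEquiv : MeasurePreserving coordEquiv volume volume :=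
  (((MeasurePreserving.id volume).prod (volume_preserving_finTwoArrow ℝ)).comp
    (volume_preserving_piFinSuccAbove (fun _ : Fin 3 => ℝ) 2)).comp
    (EuclideanSpace.volume_preserving_symm_measurableEquiv_toLp (Fin 3))

/-- The planar sector `|y| < t x`. -/
def sector (t : ℝ) : Set (ℝ × ℝ) := {z | |z.2| < z.1 * t}

lemma measurableSet_sector (t : ℝ) : MeasurableSet (sector t) :=
  (isOpen_lt (continuous_snd.abs) (continuous_fst.mul continuous_const)).measurableSet

lemma setIntegral_wedge_mul (α : ℝ) (P : ℝ × ℝ → ℝ) (s : ℝ → ℝ) :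
    ∫ x in wedge α, P (x 0, x 1) * s (x 2)
      = (∫ z in sector (Real.tan (α / 2)), P z) * ∫ y, s y := by
  have h : wedge α = coordEquiv ⁻¹' (univ ×ˢ sector (Real.tan (α / 2))) := by
    ext x
    simp [wedge, sector, coordEquiv_apply]
  have h2 := volume_preserving_coordEquiv.setIntegral_preimage_emb
    coordEquiv.measurableEmbedding (fun z => s z.1 * P z.2) (univ ×ˢ sector (Real.tan (α / 2)))
  rw [← h] at h2
  have h3 := setIntegral_prod_mul (μ := (volume : Measure ℝ)) (ν := (volume : Measure (ℝ × ℝ)))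
    s P univ (sector (Real.tan (α / 2)))
  rw [Measure.restrict_univ] at h3
  rw [mul_comm, ← h3]
  refine Eq.trans ?_ h2
  simp only [coordEquiv_apply, mul_comm]

lemma setIntegral_sector {t : ℝ} (ht : 0 < t) {p q : ℝ → ℝ} (hp : Continuous p)
    (hq : Continuous q) {M : ℝ} (hM : ∀ x, M ≤ x → p x = 0) :
    ∫ z in sector t, p z.1 * q z.2
      = ∫ x in Ioi (0 : ℝ), p x * ∫ y in (-(x * t))..(x * t), q y := by
  set F : ℝ × ℝ → ℝ := (sector t).indicator fun z => p z.1 * q z.2 with hF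
  have hint : Integrable F := by
    -- In the sector, `z.1 < M` forces `z` into this rectangle, which supplies the integrability
    -- needed for Fubini.
    have hK : IsCompact (Icc 0 M ×ˢ Icc (-(M * t)) (M * t)) := isCompact_Icc.prod isCompact_Icc
    have hc : Continuous fun z : ℝ × ℝ => p z.1 * q z.2 :=
      (hp.comp continuous_fst).mul (hq.comp continuous_snd)
    have h1 : IntegrableOn (fun z : ℝ × ℝ => p z.1 * q z.2)
      (Icc 0 M ×ˢ Icc (-(M * t)) (M * t)) := hc.continuousOn.integrableOn_compact hK
    have h2 := ((integrable_indicator_iff hK.measurableSet).2 h1).indicator (measurableSet_sector t)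
    refine h2.congr (Filter.Eventually.of_forall fun z => ?_)
    by_cases hz : z ∈ sector t
    · rw [hF, indicator_of_mem hz, indicator_of_mem hz]
      by_cases hzM : M ≤ z.1
      · by_cases hzK : z ∈ Icc 0 M ×ˢ Icc (-(M * t)) (M * t)
        · rw [indicator_of_mem hzK]
        · rw [indicator_of_notMem hzK, hM _ hzM, zero_mul]
      · rw [indicator_of_mem]
        have h3 : |z.2| < z.1 * t := hz
        have h4 : 0 < z.1 := pos_of_mul_pos_left ((abs_nonneg _).trans_lt h3) ht.le
        have h5 : z.1 * t ≤ M * t := by nlinarith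
        have h6 := abs_le.1 (h3.le.trans h5)
        exact ⟨⟨h4.le, (not_le.1 hzM).le⟩, h6⟩
    · rw [hF, indicator_of_notMem hz, indicator_of_notMem hz]
  rw [← integral_indicator (measurableSet_sector t), Measure.volume_eq_prod,
    integral_prod _ (by simpa only [Measure.volume_eq_prod] using hint),
    ← integral_indicator measurableSet_Ioi]
  refine integral_congr_ae (Filter.Eventually.of_forall fun x => ?_)
  simp only
  by_cases hx : 0 < x
  · rw [indicator_of_mem (show x ∈ Ioi (0 : ℝ) from hx)]
    have h1 : (fun y => F (x, y)) = (Ioo (-(x * t)) (x * t)).indicator fun y => p x * q y := by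
      ext y
      by_cases hy : |y| < x * t
      · rw [hF, indicator_of_mem (show (x, y) ∈ sector t from hy),
          indicator_of_mem (show y ∈ Ioo _ _ from abs_lt.1 hy)]
      · rw [hF, indicator_of_notMem (show (x, y) ∉ sector t from hy),
          indicator_of_notMem (show y ∉ Ioo _ _ from fun h => hy (abs_lt.2 h))]
    change ∫ y, (fun y => F (x, y)) y = _
    rw [h1, integral_indicator measurableSet_Ioo, integral_const_mul,
      intervalIntegral.integral_of_le (by nlinarith), integral_Ioc_eq_integral_Ioo]
  · rw [indicator_of_notMem (show x ∉ Ioi (0 : ℝ) from hx)]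
    have h1 : ∀ y, F (x, y) = 0 := fun y => by
      rw [hF, indicator_of_notMem]
      intro h
      have h3 : |y| < x * t := h
      exact hx (pos_of_mul_pos_left ((abs_nonneg _).trans_lt h3) ht.le)
    change ∫ y, F (x, y) = 0
    simp [h1]

lemma integrableOn_of_continuous {U K : Set E3} (hU : MeasurableSet U) (hK : IsCompact K)
    {F : E3 → ℝ} (hF : Continuous F) (h0 : ∀ x ∈ U \ K, F x = 0) : IntegrableOn F U := by
  have h1 : IntegrableOn F K := hF.continuousOn.integrableOn_compact hK
  have h2 : IntegrableOn (K.indicator F) U :=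
    ((integrable_indicator_iff hK.measurableSet).2 h1).integrableOn
  refine h2.congr_fun (fun x hx => ?_) hU
  by_cases hxK : x ∈ K
  · rw [indicator_of_mem hxK]
  · rw [indicator_of_notMem hxK, h0 x ⟨hx, hxK⟩]

/-- This is the source of the weight `r dr`: for `q = 1` the inner integral is `2 x tan (α / 2)`.
For `q y = y` it vanishes, and for `q y = y ^ 2` it is cubic in `x`. -/
lemma setIntegral_wedge_product {α : ℝ} (ht : 0 < Real.tan (α / 2)) {p q : ℝ → ℝ}
    (hp : Continuous p) (hq : Continuous q) (s : ℝ → ℝ) {M : ℝ} (hM : ∀ x, M ≤ x → p x = 0) :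
    ∫ x in wedge α, p (x 0) * q (x 1) * s (x 2)
      = (∫ x in Ioi (0 : ℝ), p x * ∫ y in (-(x * Real.tan (α / 2)))..(x * Real.tan (α / 2)), q y)
        * ∫ y, s y := by
  rw [← setIntegral_sector ht hp hq hM, ← setIntegral_wedge_mul α (fun z => p z.1 * q z.2) s]

lemma integral_comp_mul_pow {β : ℝ} (hβ : 0 < β) (h : ℝ → ℝ) (n : ℕ) :
    ∫ x in Ioi (0 : ℝ), h (β * x) * x ^ n = (β ^ (n + 1))⁻¹ * ∫ r in Ioi (0 : ℝ), h r * r ^ n := by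
  have := integral_comp_mul_left_Ioi (fun r => h r * (β⁻¹ * r) ^ n) 0 hβ
  simp only [inv_mul_cancel_left₀ hβ.ne', mul_zero, smul_eq_mul] at this
  rw [this]
  have h2 : ∀ r, h r * (β⁻¹ * r) ^ n = (β⁻¹) ^ n * (h r * r ^ n) := fun r => by ring
  simp_rw [h2]
  rw [integral_const_mul, ← mul_assoc]
  congr 1
  rw [inv_pow, ← mul_inv, pow_succ, mul_comm]

/-! ### Product trial functions on the wedge -/

lemma partialDeriv_mul_coord {f χ : ℝ → ℝ} (hf : ContDiff ℝ 1 f) (hχ : ContDiff ℝ 1 χ) (x : E3)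
    (j : Fin 3) :
    partialDeriv j (fun x : E3 => f (x 0) * χ (x 2)) x
      = (if j = 0 then deriv f (x 0) * χ (x 2) else 0)
        + (if j = 2 then f (x 0) * deriv χ (x 2) else 0) := by
  have h1 : HasFDerivAt (fun x : E3 => f (x 0)) _ x :=
    ((hf.differentiable one_ne_zero (x 0)).hasDerivAt).comp_hasFDerivAt x (hasFDerivAt_coord 0 x)
  have h2 : HasFDerivAt (fun x : E3 => χ (x 2)) _ x :=
    ((hχ.differentiable one_ne_zero (x 2)).hasDerivAt).comp_hasFDerivAt x (hasFDerivAt_coord 2 x)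
  rw [partialDeriv, HasFDerivAt.fderiv (f := fun x : E3 => f (x 0) * χ (x 2)) (h1.mul h2)]
  fin_cases j <;> simp
  ring

/-- Dilating a fixed bump to `b (c y)` multiplies the ratio of the two integrals by `c ^ 2`. The
wedge is invariant along its axis, so the trial function can be localised there at arbitrarily small
cost. -/
lemma exists_small_energy_cutoff {ε : ℝ} (hε : 0 < ε) :
    ∃ χ : ℝ → ℝ, ContDiff ℝ 1 χ ∧ HasCompactSupport χ ∧ 0 < ∫ y, χ y ^ 2 ∧
      ∫ y, deriv χ y ^ 2 ≤ ε * ∫ y, χ y ^ 2 := by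
  let b : ContDiffBump (0 : ℝ) := ⟨1, 2, one_pos, one_lt_two⟩
  have hb : ContDiff ℝ 1 b := b.contDiff
  have hbc : HasCompactSupport b := b.hasCompactSupport
  have hpos : 0 < ∫ y, b y ^ 2 := by
    have hc : HasCompactSupport fun y => b y ^ 2 := by
      simp_rw [pow_two]; exact hbc.mul_left
    refine Continuous.integral_pos_of_hasCompactSupport_nonneg_nonzero (x := 0)
      (hb.continuous.pow 2) hc (fun y => sq_nonneg _) ?_
    rw [b.one_of_mem_closedBall (by simp [b])]
    norm_num
  set D := ∫ y, deriv b y ^ 2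
  set N := ∫ y, b y ^ 2
  have hD : 0 ≤ D := integral_nonneg fun y => sq_nonneg _
  obtain ⟨c, hc, hcε⟩ : ∃ c : ℝ, 0 < c ∧ c ^ 2 * D ≤ ε * N := by
    refine ⟨Real.sqrt (ε * N / (D + 1)), by positivity, ?_⟩
    rw [Real.sq_sqrt (by positivity), div_mul_eq_mul_div, div_le_iff₀ (by positivity)]
    nlinarith [mul_pos hε hpos]
  have hder : ∀ y, deriv (fun y => b (c * y)) y = c * deriv b (c * y) := fun y => by
    rw [deriv_comp_mul_left]
    rfl
  refine ⟨fun y => b (c * y), hb.comp (contDiff_const.mul contDiff_id),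
    hbc.comp_homeomorph (Homeomorph.mulLeft₀ c hc.ne'), ?_, ?_⟩
  · rw [Measure.integral_comp_mul_left (fun y => b y ^ 2) c]
    positivity
  · simp_rw [hder, mul_pow]
    rw [integral_const_mul, Measure.integral_comp_mul_left (fun y => b y ^ 2) c,
      Measure.integral_comp_mul_left (fun y => deriv b y ^ 2) c, smul_eq_mul, smul_eq_mul]
    have : 0 < |c⁻¹| := by positivity
    nlinarith

lemma norm_le_of_coords {x : E3} {a b c : ℝ} (h0 : |x 0| ≤ a) (h1 : |x 1| ≤ b) (h2 : |x 2| ≤ c) :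
    ‖x‖ ≤ a + b + c := by
  have ha := (abs_nonneg _).trans h0
  have hb := (abs_nonneg _).trans h1
  have hc := (abs_nonneg _).trans h2
  rw [EuclideanSpace.norm_eq]
  refine Real.sqrt_le_iff.2 ⟨by positivity, ?_⟩
  simp only [Fin.sum_univ_three, Real.norm_eq_abs]
  nlinarith [abs_nonneg (x 0), abs_nonneg (x 1), abs_nonneg (x 2), mul_nonneg ha hb,
    mul_nonneg ha hc, mul_nonneg hb hc]

/-- Inside the wedge `|x 1|` is controlled by `x 0`, so cutting off in `x 0` and `x 2` alone gives
compact support in the closed wedge. -/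
lemma exists_compact_of_support {α : ℝ} (ht : 0 < Real.tan (α / 2)) (M R : ℝ) :
    ∃ K : Set E3, IsCompact K ∧ ∀ x ∈ wedge α \ K, M ≤ x 0 ∨ R ≤ |x 2| := by
  refine ⟨Metric.closedBall 0 (M + M * Real.tan (α / 2) + R), isCompact_closedBall _ _, ?_⟩
  rintro x ⟨hx, hxK⟩
  by_contra! hcon
  have hx' : |x 1| < x 0 * Real.tan (α / 2) := hx
  have h0 : 0 < x 0 := pos_of_mul_pos_left ((abs_nonneg _).trans_lt hx') ht.le
  refine hxK (mem_closedBall_zero_iff.2 (norm_le_of_coords ?_ ?_ hcon.2.le))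
  · rw [abs_of_pos h0]; exact hcon.1.le
  · exact hx'.le.trans (mul_le_mul_of_nonneg_right hcon.1.le ht.le)

lemma integral_symm_id (c : ℝ) : ∫ y in (-c)..c, y = 0 := by
  rw [integral_id]; ring

lemma integral_symm_sq (c : ℝ) : ∫ y in (-c)..c, y ^ 2 = 2 / 3 * c ^ 3 := by
  rw [integral_pow]; norm_num; ring

lemma integral_add_mul_add_mul_add {X : Type*} [MeasurableSpace X] {μ : Measure X}
    {f g h k : X → ℝ} (hf : Integrable f μ) (hg : Integrable g μ) (hh : Integrable h μ)
    (hk : Integrable k μ) (a b : ℝ) :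
    ∫ x, f x + a * g x + b * h x + k x ∂μ
      = ∫ x, f x ∂μ + a * ∫ x, g x ∂μ + b * ∫ x, h x ∂μ + ∫ x, k x ∂μ := by
  have i1 : Integrable (fun x => f x + a * g x) μ := hf.add (hg.const_mul a)
  have i2 : Integrable (fun x => f x + a * g x + b * h x) μ := i1.add (hh.const_mul b)
  rw [integral_add i2 hk, integral_add i1 (hh.const_mul b), integral_add hf (hg.const_mul a),
    integral_const_mul, integral_const_mul]

/-- The energy on the wedge of a trial function adapted to the radial operator. -/
theorem groundEnergy_le_radial {A : E3 →L[ℝ] E3} {B : E3} (hA : ∀ x, curl A x = B)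
    (hB : 0 < B 1) {α : ℝ} (ht : 0 < Real.tan (α / 2)) (τ : ℝ) {f : ℝ → ℝ} (hf : ContDiff ℝ 1 f)
    {M : ℝ} (hM : ∀ r, M ≤ r → f r = 0) (hN : 0 < ∫ r in Ioi (0 : ℝ), f r ^ 2 * r) :
    groundEnergy A α ≤ ((B 1 * ((∫ r in Ioi (0 : ℝ), (deriv f r ^ 2 + (r - τ) ^ 2 * f r ^ 2) * r)
        / ∫ r in Ioi (0 : ℝ), f r ^ 2 * r)
      + (B 0 ^ 2 + B 2 ^ 2) * Real.tan (α / 2) ^ 2 / (3 * B 1)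
        * ((∫ r in Ioi (0 : ℝ), f r ^ 2 * r ^ 3) / ∫ r in Ioi (0 : ℝ), f r ^ 2 * r) : ℝ)
        : EReal) := by
  set t := Real.tan (α / 2) with htdef
  set N := ∫ r in Ioi (0 : ℝ), f r ^ 2 * r with hNdef
  set Q := ∫ r in Ioi (0 : ℝ), (deriv f r ^ 2 + (r - τ) ^ 2 * f r ^ 2) * r with hQdef
  set P := ∫ r in Ioi (0 : ℝ), f r ^ 2 * r ^ 3 with hPdef
  -- The slack `ε` pays for the cut-off along the axis.
  refine EReal.le_of_forall_lt_iff_le.1 fun z hz => ?_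
  rw [EReal.coe_lt_coe_iff] at hz
  obtain ⟨ε, hε, hεz⟩ : ∃ ε > 0, B 1 * (Q / N) + (B 0 ^ 2 + B 2 ^ 2) * t ^ 2 / (3 * B 1)
      * (P / N) + ε = z := ⟨_, sub_pos.2 hz, by ring⟩
  obtain ⟨χ, hχ, hχc, hS, hS'⟩ := exists_small_energy_cutoff hε
  set S := ∫ y, χ y ^ 2 with hSdef
  set S' := ∫ y, deriv χ y ^ 2 with hSdef'
  -- The dilation by `√(B 1)` normalises the second field component to `1`, which turns `B 1 * x 0`
  -- into `β * r` with `r = β * x 0`.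
  set β := Real.sqrt (B 1) with hβdef
  have hβ : 0 < β := Real.sqrt_pos.2 hB
  have hβ2 : β ^ 2 = B 1 := Real.sq_sqrt hB.le
  let F : ℝ → ℝ := fun x => f (β * x)
  have hF : ContDiff ℝ 1 F := hf.comp (contDiff_const.mul contDiff_id)
  have hdF : ∀ x, deriv F x = β * deriv f (β * x) := fun x => by
    change deriv (fun x => f (β * x)) x = _
    rw [deriv_comp_mul_left]
    rfl
  have hFM : ∀ x, M / β ≤ x → F x = 0 := fun x hx => hM _ (by rwa [div_le_iff₀' hβ] at hx)
  -- The extra unit in `M + 1` makes `F` vanish in a whole neighbourhood of `x`, hence also its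
  -- derivative.
  have hdFM : ∀ x, (M + 1) / β ≤ x → deriv F x = 0 := fun x hx => by
    have : F =ᶠ[nhds x] fun _ => 0 := by
      filter_upwards [lt_mem_nhds (show M / β < x from lt_of_lt_of_le
        (by gcongr; linarith) hx)] with y hy using hFM y hy.le
    rw [this.deriv_eq, deriv_const]
  have hFM' : ∀ x, (M + 1) / β ≤ x → F x = 0 := fun x hx =>
    hFM x (le_trans (by gcongr; linarith) hx)
  obtain ⟨R, hR⟩ := hχc.isCompact.isBounded.subset_closedBall (0 : ℝ)
  have hχR : ∀ y, R + 1 ≤ |y| → χ y = 0 ∧ deriv χ y = 0 := fun y hy => by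
    have : y ∉ tsupport χ := fun h => by
      have := mem_closedBall_zero_iff.1 (hR h)
      rw [Real.norm_eq_abs] at this
      linarith
    exact ⟨image_eq_zero_of_notMem_tsupport this,
      Function.notMem_support.1 fun h => this (support_deriv_subset h)⟩
  obtain ⟨K, hK, hKz⟩ := exists_compact_of_support ht ((M + 1) / β) (R + 1)
  let g : E3 → ℝ := fun x => F (x 0) * χ (x 2)
  have hg : ContDiff ℝ 1 g := (hF.comp (contDiff_coord 0)).mul (hχ.comp (contDiff_coord 2))
  have hg0 : ∀ x ∈ wedge α \ K, g x = 0 := fun x hx => by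
    rcases hKz x hx with h | h
    · simp [g, hFM' _ h]
    · simp [g, (hχR _ h).1]
  have cF := hF.continuous
  have cF' := hF.continuous_deriv le_rfl
  have cχ := hχ.continuous
  have cχ' := hχ.continuous_deriv le_rfl
  have hI0 : ∫ x in Ioi (0 : ℝ), F x ^ 2 * x = (β ^ 2)⁻¹ * N := by
    simpa using integral_comp_mul_pow hβ (fun r => f r ^ 2) 1
  have hI1 : ∫ x in Ioi (0 : ℝ), (deriv F x ^ 2 + B 1 * (β * x - τ) ^ 2 * F x ^ 2) * x = Q := by
    have := integral_comp_mul_pow hβ (fun r => deriv f r ^ 2 + (r - τ) ^ 2 * f r ^ 2) 1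
    simp only [pow_one] at this
    have h2 : ∀ x, (deriv F x ^ 2 + B 1 * (β * x - τ) ^ 2 * F x ^ 2) * x
        = β ^ 2 * ((deriv f (β * x) ^ 2 + (β * x - τ) ^ 2 * f (β * x) ^ 2) * x) := fun x => by
      rw [hdF, ← hβ2]
      ring
    simp_rw [h2]
    rw [integral_const_mul, this, ← mul_assoc, mul_inv_cancel₀ (by positivity), one_mul]
  have hI3 : ∫ x in Ioi (0 : ℝ), F x ^ 2 * x ^ 3 = (β ^ 4)⁻¹ * P :=
    integral_comp_mul_pow hβ (fun r => f r ^ 2) 3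
  have hW0 : ∫ x in wedge α, g x ^ 2 = 2 * t * ((β ^ 2)⁻¹ * N) * S := by
    have := setIntegral_wedge_product ht (p := fun x => F x ^ 2) (q := fun _ => 1) (cF.pow 2)
      continuous_const (fun y => χ y ^ 2) (M := (M + 1) / β) (fun x hx => by simp [hFM' x hx])
    rw [← hI0, ← integral_const_mul (2 * t)]
    simp only [mul_one, ← mul_pow] at this
    refine this.trans ?_
    congr 1
    refine integral_congr_ae (Filter.Eventually.of_forall fun x => ?_)
    simp only [intervalIntegral.integral_const, smul_eq_mul]
    ring
  have hW1 : ∫ x in wedge α, (deriv F (x 0) ^ 2 + B 1 * (β * x 0 - τ) ^ 2 * F (x 0) ^ 2) * 1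
      * χ (x 2) ^ 2 = 2 * t * Q * S := by
    have := setIntegral_wedge_product ht
      (p := fun x => deriv F x ^ 2 + B 1 * (β * x - τ) ^ 2 * F x ^ 2) (q := fun _ => 1)
      (by fun_prop) continuous_const (fun y => χ y ^ 2) (M := (M + 1) / β)
      (fun x hx => by simp [hFM' x hx, hdFM x hx])
    rw [← hI1, ← integral_const_mul (2 * t)]
    refine this.trans ?_
    congr 1
    refine integral_congr_ae (Filter.Eventually.of_forall fun x => ?_)
    simp only [intervalIntegral.integral_const, smul_eq_mul]
    ring
  have hW2 : ∫ x in wedge α, F (x 0) ^ 2 * x 1 ^ 2 * χ (x 2) ^ 2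
      = 2 / 3 * t ^ 3 * ((β ^ 4)⁻¹ * P) * S := by
    have := setIntegral_wedge_product ht (p := fun x => F x ^ 2) (q := fun y => y ^ 2) (cF.pow 2)
      (by fun_prop) (fun y => χ y ^ 2) (M := (M + 1) / β) (fun x hx => by simp [hFM' x hx])
    rw [← hI3, ← integral_const_mul (2 / 3 * t ^ 3)]
    refine this.trans ?_
    congr 1
    refine integral_congr_ae (Filter.Eventually.of_forall fun x => ?_)
    simp only [integral_symm_sq]
    ring
  -- The cross term between the radial potential and `B 0 * x 1` is odd in `x 1`. Its vanishing
  -- makes the correction quadratic in the opening.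
  have hW3 : ∫ x in wedge α, ((β * x 0 - τ) * F (x 0) ^ 2) * x 1 * χ (x 2) ^ 2 = 0 := by
    have := setIntegral_wedge_product ht (p := fun x => (β * x - τ) * F x ^ 2) (q := fun y => y)
      (by fun_prop) continuous_id (fun y => χ y ^ 2) (M := (M + 1) / β)
      (fun x hx => by simp [hFM' x hx])
    rw [this]
    simp only [integral_symm_id, mul_zero, integral_zero, zero_mul]
  have hW4 : ∫ x in wedge α, F (x 0) ^ 2 * 1 * deriv χ (x 2) ^ 2
      = 2 * t * ((β ^ 2)⁻¹ * N) * S' := by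
    have := setIntegral_wedge_product ht (p := fun x => F x ^ 2) (q := fun _ => 1) (cF.pow 2)
      continuous_const (fun y => deriv χ y ^ 2) (M := (M + 1) / β)
      (fun x hx => by simp [hFM' x hx])
    rw [← hI0, ← integral_const_mul (2 * t)]
    refine this.trans ?_
    congr 1
    refine integral_congr_ae (Filter.Eventually.of_forall fun x => ?_)
    simp only [intervalIntegral.integral_const, smul_eq_mul]
    ring
  have hU := (isOpen_wedge α).measurableSet
  have c0 := continuous_coord 0
  have c1 := continuous_coord 1
  have c2 := continuous_coord 2
  have i1 : IntegrableOn (fun x : E3 => (deriv F (x 0) ^ 2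
      + B 1 * (β * x 0 - τ) ^ 2 * F (x 0) ^ 2) * 1 * χ (x 2) ^ 2) (wedge α) := by
    refine integrableOn_of_continuous hU hK (by fun_prop) fun x hx => ?_
    rcases hKz x hx with h | h
    · simp [hFM' _ h, hdFM _ h]
    · simp [(hχR _ h).1]
  have i2 : IntegrableOn (fun x : E3 => F (x 0) ^ 2 * x 1 ^ 2 * χ (x 2) ^ 2) (wedge α) := by
    refine integrableOn_of_continuous hU hK (by fun_prop) fun x hx => ?_
    rcases hKz x hx with h | h
    · simp [hFM' _ h]
    · simp [(hχR _ h).1]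
  have i3 : IntegrableOn (fun x : E3 => ((β * x 0 - τ) * F (x 0) ^ 2) * x 1 * χ (x 2) ^ 2)
      (wedge α) := by
    refine integrableOn_of_continuous hU hK (by fun_prop) fun x hx => ?_
    rcases hKz x hx with h | h
    · simp [hFM' _ h]
    · simp [(hχR _ h).1]
  have i4 : IntegrableOn (fun x : E3 => F (x 0) ^ 2 * 1 * deriv χ (x 2) ^ 2) (wedge α) := by
    refine integrableOn_of_continuous hU hK (by fun_prop) fun x hx => ?_
    rcases hKz x hx with h | h
    · simp [hFM' _ h]
    · simp [(hχR _ h).2]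
  -- With `k = -βτ` the last component of the potential is `B 0 * x 1 - β (β * x 0 - τ)`. Its square
  -- and `(B 2 * x 1) ^ 2` give the coefficients below.
  have hpt : ∀ x : E3, ∑ j, (partialDeriv j g x ^ 2
      + (refPotential B (-(β * τ)) x j) ^ 2 * g x ^ 2)
      = (deriv F (x 0) ^ 2 + B 1 * (β * x 0 - τ) ^ 2 * F (x 0) ^ 2) * 1 * χ (x 2) ^ 2
        + (B 0 ^ 2 + B 2 ^ 2) * (F (x 0) ^ 2 * x 1 ^ 2 * χ (x 2) ^ 2)
        + (-2 * B 0 * β) * (((β * x 0 - τ) * F (x 0) ^ 2) * x 1 * χ (x 2) ^ 2)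
        + F (x 0) ^ 2 * 1 * deriv χ (x 2) ^ 2 := fun x => by
    simp only [g, Fin.sum_univ_three, partialDeriv_mul_coord hF hχ, refPotential, ← hβ2]
    simp
    ring
  have hnum : ∫ x in wedge α, ∑ j, (partialDeriv j g x ^ 2
      + (refPotential B (-(β * τ)) x j) ^ 2 * g x ^ 2)
      = 2 * t * Q * S + (B 0 ^ 2 + B 2 ^ 2) * (2 / 3 * t ^ 3 * ((β ^ 4)⁻¹ * P) * S)
        + 2 * t * ((β ^ 2)⁻¹ * N) * S' := by
    simp_rw [hpt]
    rw [integral_add_mul_add_mul_add i1 i2 i3 i4, hW1, hW2, hW3, hW4]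
    ring
  have hpos : 0 < ∫ x in wedge α, g x ^ 2 := by
    rw [hW0]
    positivity
  refine (groundEnergy_le_of_real_trial hA (-(β * τ)) hg hK hg0 hpos).trans ?_
  rw [EReal.coe_le_coe_iff, hnum, hW0, ← hεz, div_le_iff₀ (by positivity)]
  rw [show β ^ 4 = B 1 ^ 2 by rw [← hβ2]; ring, hβ2]
  have h1 : (B 1 * (Q / N) + (B 0 ^ 2 + B 2 ^ 2) * t ^ 2 / (3 * B 1) * (P / N) + ε)
      * (2 * t * ((B 1)⁻¹ * N) * S) = 2 * t * Q * S
        + (B 0 ^ 2 + B 2 ^ 2) * (2 / 3 * t ^ 3 * ((B 1 ^ 2)⁻¹ * P) * S)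
        + 2 * t * ((B 1)⁻¹ * N) * (ε * S) := by
    field_simp
  rw [h1]
  gcongr

/-! ### Small and large openings -/

lemma one_le_tan_half {α : ℝ} (h2 : 2 ≤ α) (hπ : α < Real.pi) : 1 ≤ Real.tan (α / 2) := by
  rw [← Real.tan_pi_div_four]
  refine (Real.tan_lt_tan_of_lt_of_lt_pi_div_two ?_ ?_ ?_).le
  · linarith [Real.pi_pos]
  · linarith
  · linarith [Real.pi_lt_d2]

lemma tan_half_le {α : ℝ} (h0 : 0 < α) (h2 : α ≤ 2) : Real.tan (α / 2) ≤ α := by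
  have hcos : 1 / 2 ≤ Real.cos (α / 2) := by
    have := Real.one_sub_sq_div_two_le_cos (x := α / 2)
    nlinarith
  have hsin : Real.sin (α / 2) ≤ α / 2 := Real.sin_le (by linarith)
  rw [Real.tan_eq_sin_div_cos, div_le_iff₀ (by linarith)]
  nlinarith

/-- For large openings the ground energy is bounded by a constant depending only on the field. -/
lemma exists_groundEnergy_le_of_two_le (B : E3) :
    ∃ C : ℝ, ∀ A : E3 →L[ℝ] E3, (∀ x, curl A x = B) → ∀ α, 2 ≤ α → α < Real.pi →
      groundEnergy A α ≤ (C : EReal) := by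
  -- The ball of radius `1 / 2` about `(2, 0, 0)` satisfies `x 0 ≥ 3 / 2` and `|x 1| ≤ 1 / 2`, so it
  -- lies in every wedge with `tan (α / 2) ≥ 1`. The Rayleigh quotient of the bump is then
  -- independent of `α`.
  let c : E3 := EuclideanSpace.single 0 2
  let b : ContDiffBump c := ⟨1 / 4, 1 / 2, by norm_num, by norm_num⟩
  have hb : ContDiff ℝ 1 b := b.contDiff
  have hbt : tsupport b = Metric.closedBall c (1 / 2) := b.tsupport_eq
  refine ⟨(∫ x, ∑ j, (partialDeriv j b x ^ 2 + (refPotential B 0 x j) ^ 2 * b x ^ 2))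
    / ∫ x, b x ^ 2, fun A hA α h2 hπ => ?_⟩
  have hsub : Metric.closedBall c (1 / 2) ⊆ wedge α := by
    intro x hx
    have hn : ‖x - c‖ ≤ 1 / 2 := by rwa [← dist_eq_norm]
    have h0 := (PiLp.norm_apply_le (x - c) 0).trans hn
    have h1 := (PiLp.norm_apply_le (x - c) 1).trans hn
    simp only [PiLp.sub_apply, Real.norm_eq_abs, c, PiLp.single_apply] at h0 h1
    simp at h1
    have ht := one_le_tan_half h2 hπ
    have h3 : 3 / 2 ≤ x 0 := by
      have := (abs_le.1 h0).1
      simp at this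
      linarith
    change |x 1| < x 0 * Real.tan (α / 2)
    nlinarith
  have hb0 : ∀ x, x ∉ wedge α → b x = 0 := fun x hx =>
    image_eq_zero_of_notMem_tsupport fun h => hx (hsub (hbt ▸ h))
  have hd0 : ∀ x j, x ∉ wedge α → partialDeriv j b x = 0 := fun x j hx => by
    have : fderiv ℝ b x = 0 := image_eq_zero_of_notMem_tsupport fun h =>
      hx (hsub (hbt ▸ tsupport_fderiv_subset ℝ h))
    rw [partialDeriv, this]
    rfl
  have e1 : ∫ x in wedge α, b x ^ 2 = ∫ x, b x ^ 2 :=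
    setIntegral_eq_integral_of_forall_compl_eq_zero fun x hx => by simp [hb0 x hx]
  have e2 : ∫ x in wedge α, ∑ j, (partialDeriv j b x ^ 2 + (refPotential B 0 x j) ^ 2 * b x ^ 2)
      = ∫ x, ∑ j, (partialDeriv j b x ^ 2 + (refPotential B 0 x j) ^ 2 * b x ^ 2) :=
    setIntegral_eq_integral_of_forall_compl_eq_zero fun x hx => by simp [hb0 x hx, hd0 x _ hx]
  have hpos : 0 < ∫ x, b x ^ 2 := by
    have hc : HasCompactSupport fun x => b x ^ 2 := by
      simp_rw [pow_two]; exact b.hasCompactSupport.mul_left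
    refine Continuous.integral_pos_of_hasCompactSupport_nonneg_nonzero (x := c)
      (hb.continuous.pow 2) hc (fun y => sq_nonneg _) ?_
    rw [b.one_of_mem_closedBall (by simp [b])]
    norm_num
  have := groundEnergy_le_of_real_trial hA 0 (α := α) hb (isCompact_closedBall c (1 / 2))
    (fun x hx => image_eq_zero_of_notMem_tsupport (hbt ▸ hx.2)) (by rwa [e1])
  rwa [e1, e2] at this

/-! ### One-dimensional estimates for the radial form -/

lemma integrableOn_Ioi_of_continuous {F : ℝ → ℝ} (hF : Continuous F) {M : ℝ}
    (hM : ∀ r, M ≤ r → F r = 0) : IntegrableOn F (Ioi 0) := by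
  have h1 : IntegrableOn F (Ioc 0 M) :=
    (hF.continuousOn.integrableOn_compact isCompact_Icc).mono_set Ioc_subset_Icc_self
  refine h1.of_forall_sdiff_eq_zero measurableSet_Ioi fun x hx => hM x ?_
  by_contra h
  exact hx.2 ⟨hx.1, (not_le.1 h).le⟩

lemma setIntegral_Ioi_eq_intervalIntegral {F : ℝ → ℝ} {M : ℝ} (h0 : 0 ≤ M)
    (hM : ∀ r, M ≤ r → F r = 0) : ∫ r in Ioi (0 : ℝ), F r = ∫ r in (0 : ℝ)..M, F r := by
  rw [intervalIntegral.integral_of_le h0]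
  refine (setIntegral_eq_of_subset_of_forall_sdiff_eq_zero measurableSet_Ioi
    Ioc_subset_Ioi_self fun x hx => hM x ?_)
  by_contra h
  exact hx.2 ⟨hx.1, (not_le.1 h).le⟩

lemma deriv_eq_zero_of_vanish {f : ℝ → ℝ} {M : ℝ} (hM : ∀ r, M ≤ r → f r = 0) {r : ℝ}
    (hr : M < r) : deriv f r = 0 := by
  have : f =ᶠ[nhds r] fun _ => 0 := by
    filter_upwards [lt_mem_nhds hr] with y hy using hM y hy.le
  rw [this.deriv_eq, deriv_const]

/-- A weighted Hardy inequality on `[a, b]` by completing a square. -/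
lemma sub_le_integral_of_riccati {f : ℝ → ℝ} (hf : ContDiff ℝ 1 f) {V W W' : ℝ → ℝ} {a b : ℝ}
    (ha : 0 ≤ a) (hab : a ≤ b) (hV : Continuous V) (hW : ∀ r, HasDerivAt W (W' r) r)
    (hW' : Continuous W') (h : ∀ r ∈ Ioc a b, W' r * r + W r ^ 2 ≤ V r * r ^ 2) :
    W b * f b ^ 2 - W a * f a ^ 2 ≤ ∫ r in a..b, (deriv f r ^ 2 + V r * f r ^ 2) * r := by
  have cW : Continuous W := continuous_iff_continuousAt.2 fun r => (hW r).continuousAt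
  have cf := hf.continuous
  have cf' := hf.continuous_deriv le_rfl
  have hd : ∀ r ∈ uIcc a b, HasDerivAt (fun r => W r * f r ^ 2)
      (W' r * f r ^ 2 + W r * (2 * f r * deriv f r)) r := fun r _ => by
    have h1 := (hf.differentiable one_ne_zero r).hasDerivAt
    have h2 := (hW r).mul (h1.pow 2)
    refine h2.congr_deriv ?_
    simp
  have c1 : Continuous fun r => W' r * f r ^ 2 + W r * (2 * f r * deriv f r) := by fun_prop
  rw [← intervalIntegral.integral_eq_sub_of_hasDerivAt hd (c1.intervalIntegrable _ _),
    intervalIntegral.integral_of_le hab, intervalIntegral.integral_of_le hab]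
  refine setIntegral_mono_on ?_ ?_ measurableSet_Ioc fun r hr => ?_
  · exact (c1.intervalIntegrable a b).1
  · exact ((by fun_prop : Continuous fun r => (deriv f r ^ 2 + V r * f r ^ 2) * r).intervalIntegrable
      a b).1
  · have hr0 : 0 < r := ha.trans_lt hr.1
    have h1 := h r hr
    rw [← sub_nonneg]
    -- `W` plays the role of `r φ' / φ` for a positive comparison function `φ`. Equality in the
    -- Riccati condition would mean `(r φ')' / r = V φ`.
    have h2 : (deriv f r ^ 2 + V r * f r ^ 2) * r
        - (W' r * f r ^ 2 + W r * (2 * f r * deriv f r))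
        = (r * deriv f r - W r * f r) ^ 2 / r + (V r * r ^ 2 - (W' r * r + W r ^ 2)) * f r ^ 2 / r
        := by
      field_simp
      ring
    rw [h2]
    have h3 := mul_nonneg (sub_nonneg.2 h1) (sq_nonneg (f r))
    positivity

/-- The radial form at large `τ` is bounded below by nearly the first Landau level. -/
lemma radial_lower_bound {τ : ℝ} (hτ : 30 ≤ τ) {f : ℝ → ℝ} (hf : ContDiff ℝ 1 f) {M : ℝ}
    (hM : ∀ r, M ≤ r → f r = 0) :
    0 ≤ ∫ r in Ioi (0 : ℝ), (deriv f r ^ 2 + ((r - τ) ^ 2 - 23 / 25) * f r ^ 2) * r := by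
  set N := max (M + 1) 6 with hN
  have hMN : M + 1 ≤ N := le_max_left _ _
  have h6N : 6 ≤ N := le_max_right _ _
  have cf := hf.continuous
  have cf' := hf.continuous_deriv le_rfl
  rw [setIntegral_Ioi_eq_intervalIntegral (M := N) (by linarith) fun r hr => by
    rw [deriv_eq_zero_of_vanish hM (by linarith), hM r (by linarith)]; simp]
  have cI : Continuous fun r => (deriv f r ^ 2 + ((r - τ) ^ 2 - 23 / 25) * f r ^ 2) * r := by
    fun_prop
  rw [← intervalIntegral.integral_add_adjacent_intervals (cI.intervalIntegrable 0 6)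
    (cI.intervalIntegrable 6 N)]
  -- The shift by `6 + 1 / 12` is chosen so that the second `W` below equals `6 * σ` at `r = 6`.
  obtain ⟨σ, rfl⟩ : ∃ σ, τ = σ + 6 + 1 / 12 := ⟨τ - 6 - 1 / 12, by ring⟩
  have hσ : 20 ≤ σ := by linarith
  -- On `[0, 6]`, far from the well, `W` is a cubic with `W 0 = 0` and `W 6 = 6 * σ`. The potential
  -- is of order `σ ^ 2` there, which leaves room for a crude choice. The coefficient `57 / 10`
  -- makes the Riccati inequality hold, with `y = 1 - r / 6`.
  have h1 := sub_le_integral_of_riccati hf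
    (V := fun r => (r - (σ + 6 + 1 / 12)) ^ 2 - 23 / 25)
    (W := fun r => r ^ 2 / 6 * (2 * σ + 57 / 10 - (σ + 57 / 10) * (r / 6)))
    (W' := fun r => r / 3 * (2 * σ + 57 / 10) - r ^ 2 / 12 * (σ + 57 / 10))
    le_rfl (show (0 : ℝ) ≤ 6 by norm_num) (by fun_prop) (fun r => by
      have h1 := ((hasDerivAt_pow 2 r).div_const 6).mul
        ((((hasDerivAt_id r).div_const 6).const_mul (σ + 57 / 10)).const_sub (2 * σ + 57 / 10))
      refine h1.congr_deriv ?_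
      simp
      ring) (by fun_prop) (fun r hr => by
      obtain ⟨y, rfl⟩ : ∃ y, r = 6 * (1 - y) := ⟨1 - r / 6, by ring⟩
      have hy0 : 0 ≤ y := by linarith [hr.2]
      have hy1 : y ≤ 1 := by linarith [hr.1]
      have hA : 0 ≤ σ ^ 2 * (y ^ 2 * (2 - y ^ 2)) := by
        have : 0 ≤ 2 - y ^ 2 := by nlinarith
        positivity
      have hB1 : (1 - y) * (1 - y ^ 2) ≤ 1 := by
        nlinarith [mul_nonneg hy0 hy0, mul_nonneg hy0 (mul_nonneg hy0 (sub_nonneg.2 hy1))]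
      have hB : 2 * y ≤ σ * (y * (23 / 2 - 57 / 5 * ((1 - y) * (1 - y ^ 2)))) := by
        have : 1 / 10 * y ≤ y * (23 / 2 - 57 / 5 * ((1 - y) * (1 - y ^ 2))) := by nlinarith
        nlinarith
      have hC1 : (1 - y) ^ 2 ≤ 1 := by nlinarith
      have hC : y ^ 2 * (1 - y) ^ 2 ≤ y ^ 2 := by nlinarith [sq_nonneg y]
      have key : 0 ≤ σ ^ 2 * (y ^ 2 * (2 - y ^ 2))
          + σ * (y * (23 / 2 - 57 / 5 * ((1 - y) * (1 - y ^ 2))))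
          + ((1 / 12 + 6 * y) ^ 2 - 23 / 25 - 1 / 6 * (57 / 10 * (3 * y - 1))
            - (57 / 10) ^ 2 * (y ^ 2 * (1 - y) ^ 2)) := by nlinarith
      have := mul_nonneg key (sq_nonneg (6 * (1 - y)))
      rw [← sub_nonneg]
      refine this.trans_eq ?_
      ring)
  -- Beyond `6` the comparison function is `r^(-1/2) exp (-(r - τ)² / 2)`, which solves the equation
  -- with energy `1 - 1 / (4 r²)`. This exceeds `23 / 25` for `r > 6`. The boundary terms at `6`
  -- cancel against those of `h1`, and `f` vanishes at `N`.
  have h2 := sub_le_integral_of_riccati hf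
    (V := fun r => (r - (σ + 6 + 1 / 12)) ^ 2 - 23 / 25)
    (W := fun r => (σ + 6 + 1 / 12) * r - r ^ 2 - 1 / 2)
    (W' := fun r => σ + 6 + 1 / 12 - 2 * r)
    (show (0 : ℝ) ≤ 6 by norm_num) h6N (by fun_prop) (fun r => by
      have h1 := (((hasDerivAt_id r).const_mul (σ + 6 + 1 / 12)).sub
        (hasDerivAt_pow 2 r)).sub_const (1 / 2)
      refine h1.congr_deriv ?_
      simp) (by fun_prop) (fun r hr => by
      have : 6 < r := hr.1
      nlinarith)
  rw [hM N (by linarith)] at h2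
  norm_num at h1 h2
  have h3 : (2 * σ + 57 / 10 - (σ + 57 / 10)) = σ := by ring
  linarith

/-- A trial function with radial energy below `23 / 25` has a controlled second moment. -/
lemma radial_moment_le {τ : ℝ} {f : ℝ → ℝ} (hf : ContDiff ℝ 1 f) {M : ℝ}
    (hM : ∀ r, M ≤ r → f r = 0) (hN : 0 < ∫ r in Ioi (0 : ℝ), f r ^ 2 * r)
    (hQ : ∫ r in Ioi (0 : ℝ), (deriv f r ^ 2 + (r - τ) ^ 2 * f r ^ 2) * r
      < 23 / 25 * ∫ r in Ioi (0 : ℝ), f r ^ 2 * r) :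
    ∫ r in Ioi (0 : ℝ), f r ^ 2 * r ^ 3 ≤ 2000 * ∫ r in Ioi (0 : ℝ), f r ^ 2 * r := by
  have cf := hf.continuous
  have cf' := hf.continuous_deriv le_rfl
  have hM1 : ∀ r, M + 1 ≤ r → f r = 0 := fun r hr => hM r (by linarith)
  have hM2 : ∀ r, M + 1 ≤ r → deriv f r = 0 := fun r hr => deriv_eq_zero_of_vanish hM (by linarith)
  have iN : IntegrableOn (fun r => f r ^ 2 * r) (Ioi 0) :=
    integrableOn_Ioi_of_continuous (M := M + 1) (by fun_prop) fun r hr => by simp [hM1 r hr]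
  have iQ : IntegrableOn (fun r => (deriv f r ^ 2 + (r - τ) ^ 2 * f r ^ 2) * r) (Ioi 0) :=
    integrableOn_Ioi_of_continuous (M := M + 1) (by fun_prop) fun r hr => by
      simp [hM1 r hr, hM2 r hr]
  have iP : IntegrableOn (fun r => f r ^ 2 * r ^ 3) (Ioi 0) :=
    integrableOn_Ioi_of_continuous (M := M + 1) (by fun_prop) fun r hr => by simp [hM1 r hr]
  have hτ1 : τ < 30 := by
    by_contra! h
    have h1 := radial_lower_bound h hf hM
    have h2 : ∀ r, (deriv f r ^ 2 + ((r - τ) ^ 2 - 23 / 25) * f r ^ 2) * r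
        = (deriv f r ^ 2 + (r - τ) ^ 2 * f r ^ 2) * r - 23 / 25 * (f r ^ 2 * r) :=
      fun r => by ring
    simp_rw [h2] at h1
    rw [integral_sub iQ (iN.const_mul _), integral_const_mul] at h1
    linarith
  -- For `τ ≤ -1` the potential is at least `1` on the half-line, which contradicts an energy below
  -- `23 / 25`.
  have hτ2 : -1 < τ := by
    by_contra! h
    have h1 : ∫ r in Ioi (0 : ℝ), f r ^ 2 * r
        ≤ ∫ r in Ioi (0 : ℝ), (deriv f r ^ 2 + (r - τ) ^ 2 * f r ^ 2) * r := by
      refine setIntegral_mono_on iN iQ measurableSet_Ioi fun r hr => ?_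
      have hr0 : 0 < r := hr
      refine mul_le_mul_of_nonneg_right ?_ hr0.le
      have h2 : 1 ≤ (r - τ) ^ 2 := by nlinarith
      nlinarith [sq_nonneg (deriv f r), sq_nonneg (f r)]
    linarith
  have h1 : ∫ r in Ioi (0 : ℝ), f r ^ 2 * r ^ 3 ≤ ∫ r in Ioi (0 : ℝ),
      (2 * ((deriv f r ^ 2 + (r - τ) ^ 2 * f r ^ 2) * r) + 2 * τ ^ 2 * (f r ^ 2 * r)) := by
    refine setIntegral_mono_on iP ((iQ.const_mul _).add (iN.const_mul _)) measurableSet_Ioi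
      fun r hr => ?_
    have hr0 : 0 < r := hr
    -- Integrated against `f r ^ 2 * r`, this bounds the moment by twice the energy plus `2 * τ ^ 2`
    -- times the norm. With `|τ| ≤ 30` the total is at most `2 * 23 / 25 + 1800`, below `2000`.
    have h2 : r ^ 2 ≤ 2 * (r - τ) ^ 2 + 2 * τ ^ 2 := by nlinarith [sq_nonneg (r - 2 * τ)]
    have h3 := mul_le_mul_of_nonneg_left h2 (mul_nonneg (sq_nonneg (f r)) hr0.le)
    have h4 := mul_nonneg (sq_nonneg (deriv f r)) hr0.le
    nlinarith
  rw [integral_add (iQ.const_mul _) (iN.const_mul _), integral_const_mul, integral_const_mul] at h1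
  have h5 : τ ^ 2 ≤ 900 := by nlinarith
  nlinarith

lemma hasDerivAt_max_zero_sq (s : ℝ) :
    HasDerivAt (fun s : ℝ => max 0 s ^ 2) (2 * max 0 s) s := by
  rcases lt_trichotomy s 0 with h | rfl | h
  · rw [max_eq_left h.le, mul_zero]
    refine (hasDerivAt_const s (0 : ℝ)).congr_of_eventuallyEq ?_
    filter_upwards [gt_mem_nhds h] with y hy
    simp [max_eq_left hy.le]
  · rw [max_self, mul_zero, hasDerivAt_iff_isLittleO_nhds_zero]
    simp only [zero_add, max_self, smul_zero, sub_zero]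
    have h1 : (fun s : ℝ => max 0 s ^ 2 - 0 ^ 2) =O[nhds 0] fun s : ℝ => s ^ 2 := by
      refine Asymptotics.IsBigO.of_bound 1 (Filter.Eventually.of_forall fun y => ?_)
      rcases le_total 0 y with hy | hy
      · simp [max_eq_right hy]
      · simp [max_eq_left hy]
        positivity
    exact h1.trans_isLittleO (Asymptotics.isLittleO_pow_id one_lt_two)
  · rw [max_eq_right h.le]
    refine ((hasDerivAt_pow 2 s).congr_of_eventuallyEq ?_).congr_deriv (by simp)
    filter_upwards [lt_mem_nhds h] with y hy
    rw [max_eq_right hy.le]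

/-- An explicit trial function with radial energy at most `23 / 25`. -/
lemma exists_radial_trial :
    ∃ f : ℝ → ℝ, ContDiff ℝ 1 f ∧ (∀ r, 4 ≤ r → f r = 0) ∧
      (0 < ∫ r in Ioi (0 : ℝ), f r ^ 2 * r) ∧
      ∫ r in Ioi (0 : ℝ), (deriv f r ^ 2 + (r - 3 / 2) ^ 2 * f r ^ 2) * r
        ≤ 23 / 25 * ∫ r in Ioi (0 : ℝ), f r ^ 2 * r := by
  -- Squaring the positive part makes the function `C¹` at `r = 4`. With `τ = 3 / 2` its Rayleigh
  -- quotient is about `0.90`.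
  let f : ℝ → ℝ := fun r => max 0 (1 - r ^ 2 / 16) ^ 2
  have hd : ∀ r, HasDerivAt f (2 * max 0 (1 - r ^ 2 / 16) * (-(r / 8))) r := fun r => by
    have h1 : HasDerivAt (fun r : ℝ => 1 - r ^ 2 / 16) (-(r / 8)) r :=
      (((hasDerivAt_pow 2 r).div_const 16).const_sub 1).congr_deriv (by simp; ring)
    exact (hasDerivAt_max_zero_sq (1 - r ^ 2 / 16)).comp r h1
  have hdf : deriv f = fun r => 2 * max 0 (1 - r ^ 2 / 16) * (-(r / 8)) :=
    funext fun r => (hd r).deriv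
  have hf : ContDiff ℝ 1 f := by
    rw [contDiff_one_iff_deriv]
    refine ⟨fun r => (hd r).differentiableAt, ?_⟩
    rw [hdf]
    fun_prop
  have hv : ∀ r : ℝ, 4 ≤ r → max 0 (1 - r ^ 2 / 16) = 0 := fun r hr =>
    max_eq_left (by nlinarith)
  have hin : ∀ r ∈ uIcc (0 : ℝ) 4, max 0 (1 - r ^ 2 / 16) = 1 - r ^ 2 / 16 := fun r hr => by
    rw [uIcc_of_le (by norm_num)] at hr
    exact max_eq_right (by nlinarith [hr.1, hr.2])
  have hNv : ∫ r in Ioi (0 : ℝ), f r ^ 2 * r = 8 / 5 := by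
    rw [setIntegral_Ioi_eq_intervalIntegral (M := 4) (by norm_num) fun r hr => by simp [f, hv r hr]]
    rw [intervalIntegral.integral_congr (g := fun r => (1 - r ^ 2 / 16) ^ 4 * r) fun r hr => by
      simp only [f, hin r hr]; ring]
    have hF : ∀ r ∈ uIcc (0 : ℝ) 4, HasDerivAt (fun r : ℝ => (1 - r ^ 2 / 16) ^ 5 * (-(8 / 5)))
        ((1 - r ^ 2 / 16) ^ 4 * r) r := fun r _ => by
      have h1 := ((((hasDerivAt_pow 2 r).div_const 16).const_sub 1).pow 5).mul_const (-(8 / 5))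
      refine h1.congr_deriv ?_
      simp
      ring
    rw [intervalIntegral.integral_eq_sub_of_hasDerivAt hF
      (Continuous.intervalIntegrable (by fun_prop) _ _)]
    norm_num
  refine ⟨f, hf, fun r hr => by simp [f, hv r hr], by rw [hNv]; norm_num, ?_⟩
  rw [hNv, setIntegral_Ioi_eq_intervalIntegral (M := 4) (by norm_num) fun r hr => by
    simp [f, hdf, hv r hr]]
  rw [intervalIntegral.integral_congr (g := fun r => (1 - r ^ 2 / 16) ^ 2 * (r ^ 3 / 16)
    + (r - 3 / 2) ^ 2 * (1 - r ^ 2 / 16) ^ 4 * r) fun r hr => by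
      simp only [f, hdf, hin r hr]; ring]
  have hF : ∀ r ∈ uIcc (0 : ℝ) 4, HasDerivAt (fun r : ℝ =>
        (9/8) * r ^ 2 + (-1) * r ^ 3 + (1/8) * r ^ 4 + (3/20) * r ^ 5 + (-35/1024) * r ^ 6 +
        (-9/896) * r ^ 7 + (11/4096) * r ^ 8 + (1/3072) * r ^ 9 + (-247/2621440) * r ^ 10 +
        (-3/720896) * r ^ 11 + (1/786432) * r ^ 12)
      ((1 - r ^ 2 / 16) ^ 2 * (r ^ 3 / 16) + (r - 3 / 2) ^ 2 * (1 - r ^ 2 / 16) ^ 4 * r) r :=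
    fun r _ => by
    have h1 :=
      ((((((((((((hasDerivAt_pow 2 r).const_mul (9/8 : ℝ)).add ((hasDerivAt_pow 3 r).const_mul
      (-1 : ℝ))).add ((hasDerivAt_pow 4 r).const_mul (1/8 : ℝ))).add ((hasDerivAt_pow 5
      r).const_mul (3/20 : ℝ))).add ((hasDerivAt_pow 6 r).const_mul (-35/1024 : ℝ))).add
      ((hasDerivAt_pow 7 r).const_mul (-9/896 : ℝ))).add ((hasDerivAt_pow 8 r).const_mul
      (11/4096 : ℝ))).add ((hasDerivAt_pow 9 r).const_mul (1/3072 : ℝ))).add ((hasDerivAt_pow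
      10 r).const_mul (-247/2621440 : ℝ))).add ((hasDerivAt_pow 11 r).const_mul (-3/720896 :
      ℝ))).add ((hasDerivAt_pow 12 r).const_mul (1/786432 : ℝ)))
    refine h1.congr_deriv ?_
    norm_num
    ring
  rw [intervalIntegral.integral_eq_sub_of_hasDerivAt hF
    (Continuous.intervalIntegrable (by fun_prop) _ _)]
  norm_num

/-! ### The measure `r dr` -/

lemma measurable_ofReal_id : Measurable fun r : ℝ => ENNReal.ofReal r :=
  ENNReal.measurable_ofReal

lemma ae_radialMeasure_iff {p : ℝ → Prop} :
    (∀ᵐ r ∂radialMeasure, p r) ↔ ∀ᵐ r ∂(volume.restrict (Ioi (0 : ℝ))), p r := by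
  rw [radialMeasure, ae_withDensity_iff measurable_ofReal_id]
  constructor
  · intro h
    filter_upwards [h, ae_restrict_mem measurableSet_Ioi] with r hr hr0
    exact hr (by simpa using hr0)
  · intro h
    filter_upwards [h] with r hr _ using hr

lemma lintegral_radialMeasure (F : ℝ → ENNReal) :
    ∫⁻ r, F r ∂radialMeasure = ∫⁻ r in Ioi (0 : ℝ), ENNReal.ofReal r * F r := by
  rw [radialMeasure, lintegral_withDensity_eq_lintegral_mul_non_measurable _ measurable_ofReal_id
    (Filter.Eventually.of_forall fun r => ENNReal.ofReal_lt_top)]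
  rfl

lemma integral_radialMeasure (F : ℝ → ℝ) :
    ∫ r, F r ∂radialMeasure = ∫ r in Ioi (0 : ℝ), F r * r := by
  rw [radialMeasure, integral_withDensity_eq_integral_toReal_smul measurable_ofReal_id
    (Filter.Eventually.of_forall fun r => ENNReal.ofReal_lt_top)]
  refine setIntegral_congr_fun measurableSet_Ioi fun r hr => ?_
  have hr0 : 0 < r := hr
  simp only [ENNReal.toReal_ofReal hr0.le, smul_eq_mul, mul_comm]

/-- The weight is at least `δ` on `(δ, ∞)`. Away from the origin, square integrability for `r dr`
therefore implies it for Lebesgue measure. -/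
lemma restrict_Ioi_le_smul {δ : ℝ} (hδ : 0 < δ) :
    volume.restrict (Ioi δ) ≤ ENNReal.ofReal δ⁻¹ • radialMeasure := by
  rw [Measure.le_iff]
  intro s hs
  rw [Measure.smul_apply, smul_eq_mul, radialMeasure, withDensity_apply _ hs,
    Measure.restrict_restrict hs, Measure.restrict_apply hs]
  have h1 : ENNReal.ofReal δ * volume (s ∩ Ioi δ)
      ≤ ∫⁻ r in s ∩ Ioi 0, ENNReal.ofReal r := by
    rw [← setLIntegral_const]
    refine (setLIntegral_mono' (hs.inter measurableSet_Ioi) fun r hr =>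
      ENNReal.ofReal_le_ofReal (le_of_lt hr.2)).trans
      (lintegral_mono_set (inter_subset_inter_right _ (Ioi_subset_Ioi hδ.le)))
  calc volume (s ∩ Ioi δ) = ENNReal.ofReal δ⁻¹ * (ENNReal.ofReal δ * volume (s ∩ Ioi δ)) := by
        rw [← mul_assoc, ← ENNReal.ofReal_mul (by positivity), inv_mul_cancel₀ hδ.ne',
          ENNReal.ofReal_one, one_mul]
    _ ≤ _ := by gcongr

lemma integrableOn_of_memLp_radial {u : ℝ → ℂ} (hu : MemLp u 2 radialMeasure) {δ : ℝ}
    (hδ : 0 < δ) (M : ℝ) : IntegrableOn u (Icc δ M) := by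
  rw [integrableOn_Icc_iff_integrableOn_Ioc]
  have h1 : MemLp u 2 (volume.restrict (Ioi δ)) :=
    hu.of_measure_le_smul ENNReal.ofReal_ne_top (restrict_Ioi_le_smul hδ)
  have h2 : MemLp u 2 (volume.restrict (Ioc δ M)) :=
    h1.mono_measure (Measure.restrict_mono Ioc_subset_Ioi_self le_rfl)
  exact h2.integrable (by norm_num)

instance : IsLocallyFiniteMeasure radialMeasure :=
  IsLocallyFiniteMeasure.withDensity_ofReal continuous_id

lemma norm_sq_eq_integral_Ioi {u : L2r} {f : ℝ → ℂ} (h : u =ᵐ[radialMeasure] f) :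
    ‖u‖ ^ 2 = ∫ r in Ioi (0 : ℝ), ‖f r‖ ^ 2 * r := by
  rw [← integral_radialMeasure (fun r => ‖f r‖ ^ 2)]
  have h1 := norm_toLp_sq (Lp.memLp u)
  rw [Lp.toLp_coeFn] at h1
  rw [h1]
  refine integral_congr_ae ?_
  filter_upwards [h] with r hr
  rw [hr]

/-! ### A Hardy inequality for primitives -/

lemma eLpNorm_two_eq {X : Type*} [MeasurableSpace X] {μ : Measure X} (f : X → ℂ) :
    eLpNorm f 2 μ = (∫⁻ x, ‖f x‖ₑ ^ (2 : ℝ) ∂μ) ^ (1 / 2 : ℝ) := by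
  rw [eLpNorm_eq_lintegral_rpow_enorm_toReal two_ne_zero ENNReal.ofNat_ne_top]
  simp

lemma lintegral_enorm_sq_le {s M : ℝ} {k : ℝ → ℂ}
    (hk : AEStronglyMeasurable k (volume.restrict (Ioc s M))) :
    (∫⁻ r in Ioc s M, ‖k r‖ₑ) ^ (2 : ℝ)
      ≤ (∫⁻ r in Ioc s M, ‖k r‖ₑ ^ (2 : ℝ)) * ENNReal.ofReal (M - s) := by
  have h := eLpNorm_le_eLpNorm_mul_rpow_measure_univ (p := 1) (q := 2) (by norm_num) hk
  rw [eLpNorm_one_eq_lintegral_enorm, eLpNorm_two_eq, Measure.restrict_apply_univ,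
    Real.volume_Ioc] at h
  refine (ENNReal.rpow_le_rpow h (by norm_num : (0 : ℝ) ≤ 2)).trans_eq ?_
  rw [ENNReal.mul_rpow_of_nonneg _ _ (by norm_num), ← ENNReal.rpow_mul, ← ENNReal.rpow_mul]
  norm_num

/-- For `0 < s ≤ M`, Cauchy–Schwarz on `(s, M]` gives `|∫ k|² ≤ M ∫ |k|² ≤ (M / s) ∫ |k|² r dr`. The
weight `s` of the outer measure cancels `1 / s`, and integrating over `(0, M]` yields the factor `M
^ 2`. -/
lemma eLpNorm_primitive_le {k : ℝ → ℂ}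
    (hk : AEStronglyMeasurable k (volume.restrict (Ioi (0 : ℝ)))) {M : ℝ}
    (hM : ∀ r, M < r → k r = 0) :
    eLpNorm (fun s => ∫ r in Ioi s, k r) 2 radialMeasure
      ≤ ENNReal.ofReal M * eLpNorm k 2 radialMeasure := by
  set I := ∫⁻ r, ‖k r‖ₑ ^ (2 : ℝ) ∂radialMeasure with hI
  have hpt : ∀ s ∈ Ioi (0 : ℝ), ENNReal.ofReal s * ‖∫ r in Ioi s, k r‖ₑ ^ (2 : ℝ)
      ≤ (Ioc 0 M).indicator (fun _ => ENNReal.ofReal M * I) s := by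
    intro s hs
    have hs0 : 0 < s := hs
    have h0 : ∫ r in Ioi s, k r = ∫ r in Ioc s M, k r :=
      setIntegral_eq_of_subset_of_forall_sdiff_eq_zero measurableSet_Ioi Ioc_subset_Ioi_self
        fun x hx => hM x (by
          by_contra h
          exact hx.2 ⟨hx.1, not_lt.1 h⟩)
    by_cases hsM : s ≤ M
    · rw [indicator_of_mem (show s ∈ Ioc 0 M from ⟨hs0, hsM⟩), h0]
      have h1 := lintegral_enorm_sq_le (M := M) (hk.mono_measure (Measure.restrict_mono
        (Ioc_subset_Ioi_self.trans (Ioi_subset_Ioi hs0.le)) le_rfl))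
      have h2 : ∫⁻ r in Ioc s M, ‖k r‖ₑ ^ (2 : ℝ) ≤ ENNReal.ofReal s⁻¹ * I := by
        refine (lintegral_mono_set Ioc_subset_Ioi_self).trans ?_
        refine (lintegral_mono' (restrict_Ioi_le_smul hs0) le_rfl).trans_eq ?_
        rw [lintegral_smul_measure, smul_eq_mul]
      calc ENNReal.ofReal s * ‖∫ r in Ioc s M, k r‖ₑ ^ (2 : ℝ)
          ≤ ENNReal.ofReal s * ((ENNReal.ofReal s⁻¹ * I) * ENNReal.ofReal M) := by
            gcongr
            refine (ENNReal.rpow_le_rpow (enorm_integral_le_lintegral_enorm _)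
              (by norm_num)).trans (h1.trans ?_)
            gcongr
            linarith
        _ = (ENNReal.ofReal s * ENNReal.ofReal s⁻¹) * (ENNReal.ofReal M * I) := by ring
        _ = _ := by
            rw [← ENNReal.ofReal_mul hs0.le, mul_inv_cancel₀ hs0.ne', ENNReal.ofReal_one, one_mul]
    · rw [h0, Ioc_eq_empty (by simpa using (not_le.1 hsM).le)]
      simp
  have hsq : ∫⁻ s, ‖∫ r in Ioi s, k r‖ₑ ^ (2 : ℝ) ∂radialMeasure
      ≤ ENNReal.ofReal M ^ (2 : ℝ) * I := by
    rw [lintegral_radialMeasure]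
    refine (setLIntegral_mono' measurableSet_Ioi hpt).trans ?_
    refine (setLIntegral_le_lintegral _ _).trans ?_
    rw [lintegral_indicator measurableSet_Ioc, setLIntegral_const, Real.volume_Ioc, sub_zero,
      ENNReal.rpow_two]
    exact le_of_eq (by ring)
  rw [eLpNorm_two_eq, eLpNorm_two_eq, ← hI]
  refine (ENNReal.rpow_le_rpow hsq (by norm_num)).trans_eq ?_
  rw [ENNReal.mul_rpow_of_nonneg _ _ (by norm_num), ← ENNReal.rpow_mul]
  norm_num

lemma contDiff_primitive {ψ : ℝ → ℝ} (hψ : ContDiff ℝ ∞ ψ) :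
    ContDiff ℝ ∞ fun r => ∫ s in (0 : ℝ)..r, ψ s := by
  rw [contDiff_infty_iff_deriv]
  refine ⟨fun r => (hψ.continuous.integral_hasStrictDerivAt 0 r).hasDerivAt.differentiableAt, ?_⟩
  rwa [show deriv (fun r => ∫ s in (0 : ℝ)..r, ψ s) = ψ from
    funext fun r => hψ.continuous.deriv_integral _ 0 r]

lemma integrable_indicator_mul_continuous {u : ℝ → ℂ} {δ M : ℝ} (hu : IntegrableOn u (Icc δ M))
    {a : ℝ → ℂ} (ha : Continuous a) (haM : ∀ r, M ≤ r → a r = 0) :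
    IntegrableOn (fun r => u r * a r) (Ioi δ) := by
  have h1 := (hu.mul_continuousOn ha.continuousOn isCompact_Icc).mono_set Ioc_subset_Icc_self
  refine h1.of_forall_sdiff_eq_zero measurableSet_Ioi fun x hx => ?_
  rw [haM x, mul_zero]
  by_contra h
  exact hx.2 ⟨hx.1, (not_le.1 h).le⟩

/-- Fubini for a primitive tested against a function. -/
lemma integral_mul_primitive {G : ℝ → ℂ} (hG : Integrable G) {ψ : ℝ → ℝ} (hψ : Integrable ψ) :
    ∫ r, G r * ((∫ s in Iio r, ψ s : ℝ) : ℂ) = ∫ s, ψ s • ∫ r in Ioi s, G r := by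
  have hψC : Integrable fun s => (ψ s : ℂ) := hψ.ofReal
  have hS : MeasurableSet {p : ℝ × ℝ | p.2 < p.1} := measurableSet_lt measurable_snd measurable_fst
  have hint : Integrable (Function.uncurry fun r s =>
      {p : ℝ × ℝ | p.2 < p.1}.indicator (fun p => G p.1 * (ψ p.2 : ℂ)) (r, s))
      (volume.prod volume) := (hG.mul_prod hψC).indicator hS
  have h1 := integral_integral_swap hint
  have e1 : ∀ r, ∫ s, {p : ℝ × ℝ | p.2 < p.1}.indicator (fun p => G p.1 * (ψ p.2 : ℂ)) (r, s)
      = G r * ((∫ s in Iio r, ψ s : ℝ) : ℂ) := fun r => by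
    rw [← integral_complex_ofReal, ← integral_const_mul, ← integral_indicator measurableSet_Iio]
    rfl
  have e2 : ∀ s, ∫ r, {p : ℝ × ℝ | p.2 < p.1}.indicator (fun p => G p.1 * (ψ p.2 : ℂ)) (r, s)
      = ψ s • ∫ r in Ioi s, G r := fun s => by
    rw [Complex.real_smul, mul_comm, ← integral_mul_const, ← integral_indicator measurableSet_Ioi]
    rfl
  simp_rw [e1, e2] at h1
  exact h1

/-- The cut-off of a function with a weak derivative is the primitive of its weak derivative. -/
lemma cutoff_eq_primitive {u g : L2r} (hug : IsWeakDeriv u g) {χ : ℝ → ℝ} (hχ : ContDiff ℝ ∞ χ)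
    {M : ℝ} (hM : ∀ r, M ≤ r → χ r = 0) :
    ∀ᵐ r ∂radialMeasure, (χ r : ℂ) * u r
      = -∫ s in Ioi r, ((χ s : ℂ) * g s + ((deriv χ s : ℝ) : ℂ) * u s) := by
  set G : ℝ → ℂ := fun s => (χ s : ℂ) * g s + ((deriv χ s : ℝ) : ℂ) * u s with hG
  have hM1 : ∀ r, M + 1 ≤ r → χ r = 0 := fun r hr => hM r (by linarith)
  have hM2 : ∀ r, M + 1 ≤ r → deriv χ r = 0 := fun r hr => deriv_eq_zero_of_vanish hM (by linarith)
  have cχ : Continuous fun r => (χ r : ℂ) := Complex.continuous_ofReal.comp hχ.continuous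
  have cχ' : Continuous fun r => ((deriv χ r : ℝ) : ℂ) :=
    Complex.continuous_ofReal.comp (hχ.continuous_deriv (by simp))
  -- Local integrability is only available away from the origin, so the identity is proved on each
  -- `(δ, ∞)` and then on a countable union of such intervals.
  have key : ∀ δ > 0, ∀ᵐ r ∂(volume : Measure ℝ), r ∈ Ioi δ → (χ r : ℂ) * u r
      + ∫ s in Ioi r, G s = 0 := by
    intro δ hδ
    have hu := integrableOn_of_memLp_radial (Lp.memLp u) hδ (M + 1)
    have hg := integrableOn_of_memLp_radial (Lp.memLp g) hδ (M + 1)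
    have iu : IntegrableOn (fun r => (χ r : ℂ) * u r) (Ioi δ) := by
      simpa only [mul_comm] using
        integrable_indicator_mul_continuous hu cχ (fun r hr => by simp [hM1 r hr])
    have iG : IntegrableOn G (Ioi δ) := by
      refine IntegrableOn.add ?_ ?_
      · simpa only [mul_comm] using
          integrable_indicator_mul_continuous hg cχ (fun r hr => by simp [hM1 r hr])
      · simpa only [mul_comm] using
          integrable_indicator_mul_continuous hu cχ' (fun r hr => by simp [hM2 r hr])
    set Gδ : ℝ → ℂ := (Ioi δ).indicator G with hGδ
    have iGδ : Integrable Gδ := (integrable_indicator_iff measurableSet_Ioi).2 iG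
    have hH : ∀ r, δ < r → ∫ s in Ioi r, G s = ∫ s in Ioi r, Gδ s := fun r hr => by
      refine setIntegral_congr_fun measurableSet_Ioi fun s hs => ?_
      rw [hGδ, indicator_of_mem (show s ∈ Ioi δ from hr.trans hs)]
    have cH : Continuous fun r => ∫ s in Ioi r, Gδ s := by
      have : (fun r => ∫ s in Ioi r, Gδ s) = fun r => (∫ s in Ioi 0, Gδ s)
          - ∫ s in (0 : ℝ)..r, Gδ s := by
        ext r
        rw [← intervalIntegral.integral_Ioi_sub_Ioi' iGδ.integrableOn iGδ.integrableOn]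
        ring
      rw [this]
      exact continuous_const.sub (intervalIntegral.continuous_primitive
        (fun a b => iGδ.intervalIntegrable) 0)
    have iv : LocallyIntegrableOn (fun r => (χ r : ℂ) * u r + ∫ s in Ioi r, Gδ s) (Ioi δ) :=
      iu.locallyIntegrableOn.add (cH.locallyIntegrable.locallyIntegrableOn _)
    -- By the fundamental lemma of the calculus of variations it suffices to test the identity
    -- against `ψ` supported in `(δ, ∞)`.
    have h0 := isOpen_Ioi.ae_eq_zero_of_integral_contDiff_smul_eq_zero iv ?_
    · filter_upwards [h0] with r hr hrδ
      rw [hH r hrδ]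
      exact hr hrδ
    intro ψ hψ hψc hψs
    have hψ0 : ∀ s, s ≤ δ → ψ s = 0 := fun s hs =>
      image_eq_zero_of_notMem_tsupport fun h => absurd (hψs h) (not_lt.2 hs)
    have iψ : Integrable ψ := hψ.continuous.integrable_of_hasCompactSupport hψc
    set Ψ : ℝ → ℝ := fun r => ∫ s in (0 : ℝ)..r, ψ s with hΨ
    have hΨs : ContDiff ℝ ∞ Ψ := contDiff_primitive hψ
    have hΨd : ∀ r, deriv Ψ r = ψ r := fun r => hψ.continuous.deriv_integral _ 0 r
    have hΨI : ∀ r, Ψ r = ∫ s in Iio r, ψ s := fun r => by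
      have h1 : ∫ s in Iic (0 : ℝ), ψ s = 0 := by
        refine setIntegral_eq_zero_of_forall_eq_zero fun s hs => hψ0 s (le_trans hs hδ.le)
      change ∫ s in (0 : ℝ)..r, ψ s = _
      rw [← integral_Iic_eq_integral_Iio, ← intervalIntegral.integral_Iic_sub_Iic
        iψ.integrableOn iψ.integrableOn, h1, sub_zero]
    have hΨ0 : ∀ r, r ≤ δ → Ψ r = 0 := fun r hr => by
      rw [hΨI]
      exact setIntegral_eq_zero_of_forall_eq_zero fun s hs => hψ0 s (le_trans (le_of_lt hs) hr)
    -- The primitive `Ψ` of `ψ` is constant for large `r`, but `χ * Ψ` has compact support and is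
    -- admissible in the weak derivative. Fubini turns the primitive of `G` tested against `ψ` into
    -- `G` tested against `Ψ`.
    set φ : ℝ → ℂ := fun r => ((χ r * Ψ r : ℝ) : ℂ) with hφ
    have hφ0 : ∀ r, r ∉ Icc δ M → φ r = 0 := fun r hr => by
      rcases le_or_gt r δ with h | h
      · simp [hφ, hΨ0 r h]
      · have : M ≤ r := by
          by_contra hc
          exact hr ⟨h.le, (not_le.1 hc).le⟩
        simp [hφ, hM r this]
    have hφs : ContDiff ℝ ∞ φ := Complex.ofRealCLM.contDiff.comp (hχ.mul hΨs)
    have hφt : tsupport φ ⊆ Icc δ M := closure_minimal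
      (fun r hr => by
        by_contra h
        exact hr (hφ0 r h)) isClosed_Icc
    have hφd : ∀ r, deriv φ r = ((deriv χ r : ℝ) : ℂ) * Ψ r + (χ r : ℂ) * ψ r := fun r => by
      have h1 := ((hχ.differentiable (by simp) r).hasDerivAt).mul
        ((hΨs.differentiable (by simp) r).hasDerivAt)
      rw [hΨd] at h1
      have h2 : HasDerivAt φ ((deriv χ r * Ψ r + χ r * ψ r : ℝ) : ℂ) r := h1.ofReal_comp
      rw [h2.deriv]
      push_cast
      ring
    have hw := hug φ hφs (HasCompactSupport.of_support_subset_isCompact isCompact_Icc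
      ((subset_tsupport _).trans hφt)) (hφt.trans fun r hr => hδ.trans_le hr.1)
    have cΨ : Continuous fun r => (Ψ r : ℂ) := Complex.continuous_ofReal.comp hΨs.continuous
    have cψ : Continuous fun r => (ψ r : ℂ) := Complex.continuous_ofReal.comp hψ.continuous
    have hI : ∀ F : ℝ → ℂ, (∀ r, r ≤ δ → F r = 0) →
        ∫ r in Ioi (0 : ℝ), F r = ∫ r in Ioi δ, F r := fun F hF =>
      setIntegral_eq_of_subset_of_forall_sdiff_eq_zero measurableSet_Ioi (Ioi_subset_Ioi hδ.le)
        fun x hx => hF x (not_lt.1 hx.2)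
    rw [hI _ fun r hr => by rw [hφd]; simp [hΨ0 r hr, hψ0 r hr],
      hI _ fun r hr => by simp [hφ, hΨ0 r hr]] at hw
    have j1 : IntegrableOn (fun r => u r * (((deriv χ r : ℝ) : ℂ) * Ψ r)) (Ioi δ) :=
      integrable_indicator_mul_continuous hu (cχ'.mul cΨ) (fun r hr => by simp [hM2 r hr])
    have j2 : IntegrableOn (fun r => u r * ((χ r : ℂ) * ψ r)) (Ioi δ) :=
      integrable_indicator_mul_continuous hu (cχ.mul cψ) (fun r hr => by simp [hM1 r hr])
    have j3 : IntegrableOn (fun r => g r * ((χ r : ℂ) * Ψ r)) (Ioi δ) :=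
      integrable_indicator_mul_continuous hg (cχ.mul cΨ) (fun r hr => by simp [hM1 r hr])
    have e1 : ∫ r in Ioi δ, u r * deriv φ r = (∫ r in Ioi δ, u r * (((deriv χ r : ℝ) : ℂ) * Ψ r))
        + ∫ r in Ioi δ, u r * ((χ r : ℂ) * ψ r) := by
      rw [← integral_add j1 j2]
      simp_rw [hφd, mul_add]
    have e2 : ∫ r in Ioi δ, g r * φ r = ∫ r in Ioi δ, g r * ((χ r : ℂ) * Ψ r) := by
      simp only [hφ, Complex.ofReal_mul]
    have e3 : ∫ r, Gδ r * ((∫ s in Iio r, ψ s : ℝ) : ℂ)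
        = (∫ r in Ioi δ, g r * ((χ r : ℂ) * Ψ r))
          + ∫ r in Ioi δ, u r * (((deriv χ r : ℝ) : ℂ) * Ψ r) := by
      rw [← integral_add j3 j1, ← integral_indicator measurableSet_Ioi]
      refine integral_congr_ae (Filter.Eventually.of_forall fun r => ?_)
      simp only [← hΨI]
      by_cases hr : r ∈ Ioi δ
      · rw [hGδ, indicator_of_mem hr, indicator_of_mem hr, hG]
        ring
      · rw [hGδ, indicator_of_notMem hr, indicator_of_notMem hr, zero_mul]
    have e4 : ∫ r, ψ r • ((χ r : ℂ) * u r) = ∫ r in Ioi δ, u r * ((χ r : ℂ) * ψ r) := by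
      rw [← integral_indicator measurableSet_Ioi]
      refine integral_congr_ae (Filter.Eventually.of_forall fun r => ?_)
      simp only
      by_cases hr : r ∈ Ioi δ
      · rw [indicator_of_mem hr, Complex.real_smul]
        ring
      · rw [indicator_of_notMem hr, hψ0 r (not_lt.1 hr), zero_smul]
    have j4 : Integrable fun r => ψ r • ((χ r : ℂ) * u r) := by
      refine ((integrable_indicator_iff measurableSet_Ioi).2 j2).congr
        (Filter.Eventually.of_forall fun r => ?_)
      simp only
      by_cases hr : r ∈ Ioi δ
      · rw [indicator_of_mem hr, Complex.real_smul]
        ring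
      · rw [indicator_of_notMem hr, hψ0 r (not_lt.1 hr), zero_smul]
    have j5 : Integrable fun r => ψ r • ∫ s in Ioi r, Gδ s :=
      (hψ.continuous.smul cH).integrable_of_hasCompactSupport hψc.smul_right
    simp_rw [smul_add]
    rw [integral_add j4 j5, ← integral_mul_primitive iGδ iψ, e3, e4]
    rw [e1, e2] at hw
    linear_combination hw
  rw [ae_radialMeasure_iff, ae_restrict_iff' measurableSet_Ioi]
  have hall : ∀ᵐ r ∂(volume : Measure ℝ), ∀ n : ℕ, r ∈ Ioi (1 / ((n : ℝ) + 1)) →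
      (χ r : ℂ) * u r + ∫ s in Ioi r, G s = 0 :=
    ae_all_iff.2 fun n => key _ (by positivity)
  filter_upwards [hall] with r hr hr0
  obtain ⟨n, hn⟩ := exists_nat_one_div_lt (show (0 : ℝ) < r from hr0)
  exact eq_neg_of_add_eq_zero_left (hr n hn)

lemma memLp_radial_of_continuous {F : ℝ → ℂ} (hF : Continuous F) {M : ℝ}
    (hM : ∀ r, M ≤ r → F r = 0) : MemLp F 2 radialMeasure := by
  have h1 : MemLp F 2 (radialMeasure.restrict (Icc 0 M)) := by
    obtain ⟨C, hC⟩ := isCompact_Icc.exists_bound_of_continuousOn (s := Icc 0 M) hF.continuousOn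
    have : IsFiniteMeasure (radialMeasure.restrict (Icc 0 M)) :=
      ⟨by rw [Measure.restrict_apply_univ]; exact isCompact_Icc.measure_lt_top⟩
    refine MemLp.of_bound hF.aestronglyMeasurable C ?_
    exact (ae_restrict_iff' measurableSet_Icc).2 (Filter.Eventually.of_forall hC)
  refine ((memLp_indicator_iff_restrict measurableSet_Icc).2 h1).ae_eq ?_
  refine ae_radialMeasure_iff.2 ?_
  filter_upwards [ae_restrict_mem measurableSet_Ioi] with r hr
  by_cases hrM : r ≤ M
  · rw [indicator_of_mem (show r ∈ Icc 0 M from ⟨le_of_lt hr, hrM⟩)]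
  · rw [indicator_of_notMem (fun h => hrM h.2), hM r (not_le.1 hrM).le]

lemma tendsto_L2r_of_dominated {w : L2r} {v : ℕ → L2r} {b : ℝ → ℝ} (hb : MemLp b 2 radialMeasure)
    (h1 : ∀ n, ∀ᵐ r ∂radialMeasure, ‖v n r - w r‖ ≤ b r)
    (h2 : ∀ᵐ r ∂radialMeasure, ∀ᶠ n in Filter.atTop, v n r = w r) :
    Filter.Tendsto v Filter.atTop (nhds w) := by
  rw [tendsto_iff_edist_tendsto_0]
  simp_rw [Lp.edist_def, eLpNorm_two_eq]
  have hlim : Filter.Tendsto (fun n => ∫⁻ r, ‖(⇑(v n) - ⇑w) r‖ₑ ^ (2 : ℝ) ∂radialMeasure)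
      Filter.atTop (nhds (∫⁻ _, 0 ∂radialMeasure)) := by
    refine tendsto_lintegral_of_dominated_convergence (fun r => ‖b r‖ₑ ^ (2 : ℝ)) (fun n => ?_)
      (fun n => ?_) ?_ ?_
    · exact (((Lp.stronglyMeasurable (v n)).sub (Lp.stronglyMeasurable w)).measurable.enorm).pow_const
        _
    · filter_upwards [h1 n] with r hr
      refine ENNReal.rpow_le_rpow ?_ (by norm_num)
      rw [enorm_le_iff_norm_le]
      exact hr.trans (le_abs_self _)
    · have := lintegral_rpow_enorm_lt_top_of_eLpNorm_lt_top two_ne_zero ENNReal.ofNat_ne_top hb.2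
      simpa using this.ne
    · filter_upwards [h2] with r hr
      refine tendsto_const_nhds.congr' ?_
      filter_upwards [hr] with n hn
      simp [hn]
  rw [lintegral_zero] at hlim
  have := hlim.ennrpow_const (1 / 2)
  simpa using this

/-! ### Density of the `C¹` core in the radial form domain -/

/-- The triples `(f, f', (r - τ) f)` for `C¹` functions `f` vanishing for large `r`. -/
def radialCore (τ : ℝ) : Set (L2r × L2r × L2r) :=
  {z | ∃ f : ℝ → ℂ, ContDiff ℝ 1 f ∧ (∃ M, ∀ r, M ≤ r → f r = 0) ∧ z.1 =ᵐ[radialMeasure] f ∧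
    z.2.1 =ᵐ[radialMeasure] deriv f ∧
    z.2.2 =ᵐ[radialMeasure] fun r => ((r - τ : ℝ) : ℂ) * f r}

lemma integrableOn_cutoff_deriv (u g : L2r) {χ : ℝ → ℝ} (hχ : ContDiff ℝ ∞ χ)
    {M : ℝ} (hM : ∀ r, M ≤ r → χ r = 0) {δ : ℝ} (hδ : 0 < δ) :
    IntegrableOn (fun s => (χ s : ℂ) * g s + ((deriv χ s : ℝ) : ℂ) * u s) (Ioi δ) := by
  have hM1 : ∀ r, M + 1 ≤ r → χ r = 0 := fun r hr => hM r (by linarith)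
  have hM2 : ∀ r, M + 1 ≤ r → deriv χ r = 0 := fun r hr => deriv_eq_zero_of_vanish hM (by linarith)
  have cχ : Continuous fun r => (χ r : ℂ) := Complex.continuous_ofReal.comp hχ.continuous
  have cχ' : Continuous fun r => ((deriv χ r : ℝ) : ℂ) :=
    Complex.continuous_ofReal.comp (hχ.continuous_deriv (by simp))
  have hu := integrableOn_of_memLp_radial (Lp.memLp u) hδ (M + 1)
  have hg := integrableOn_of_memLp_radial (Lp.memLp g) hδ (M + 1)
  refine IntegrableOn.add ?_ ?_
  · simpa only [mul_comm] using
      integrable_indicator_mul_continuous hg cχ (fun r hr => by simp [hM1 r hr])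
  · simpa only [mul_comm] using
      integrable_indicator_mul_continuous hu cχ' (fun r hr => by simp [hM2 r hr])

lemma hasDerivAt_neg_integral_Ioi {k : ℝ → ℂ} (hk : Continuous k) (hki : Integrable k) (r : ℝ) :
    HasDerivAt (fun s => -∫ t in Ioi s, k t) (k r) r := by
  have : (fun s => -∫ t in Ioi s, k t) = fun s => (∫ t in (0 : ℝ)..s, k t) - ∫ t in Ioi 0, k t := by
    ext s
    rw [← intervalIntegral.integral_Ioi_sub_Ioi' hki.integrableOn hki.integrableOn]
    ring
  rw [this]
  exact (hk.integral_hasStrictDerivAt 0 r).hasDerivAt.sub_const _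

/-- A smooth cut-off equal to `1` for `r ≤ a` and to `0` for `r ≥ a + 1`. -/
def cutoff (a r : ℝ) : ℝ := 1 - Real.smoothTransition (r - a)

lemma contDiff_cutoff (a : ℝ) : ContDiff ℝ ∞ (cutoff a) :=
  contDiff_const.sub (Real.smoothTransition.contDiff.comp (contDiff_id.sub contDiff_const))

lemma cutoff_of_le {a r : ℝ} (h : r ≤ a) : cutoff a r = 1 := by
  rw [cutoff, Real.smoothTransition.zero_of_nonpos (by linarith), sub_zero]

lemma cutoff_of_ge {a r : ℝ} (h : a + 1 ≤ r) : cutoff a r = 0 := by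
  rw [cutoff, Real.smoothTransition.one_of_one_le (by linarith), sub_self]

lemma abs_cutoff_le (a r : ℝ) : |cutoff a r| ≤ 1 := by
  rw [cutoff, abs_le]
  constructor <;> linarith [Real.smoothTransition.nonneg (r - a),
    Real.smoothTransition.le_one (r - a)]

lemma abs_cutoff_sub_one_le (a r : ℝ) : |cutoff a r - 1| ≤ 1 := by
  rw [cutoff, abs_le]
  constructor <;> linarith [Real.smoothTransition.nonneg (r - a),
    Real.smoothTransition.le_one (r - a)]

lemma deriv_cutoff_of_lt {a r : ℝ} (h : r < a) : deriv (cutoff a) r = 0 := by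
  have : cutoff a =ᶠ[nhds r] fun _ => 1 := by
    filter_upwards [gt_mem_nhds h] with y hy using cutoff_of_le (le_of_lt hy)
  rw [this.deriv_eq, deriv_const]

lemma exists_abs_deriv_cutoff_le : ∃ C, 0 ≤ C ∧ ∀ a r, |deriv (cutoff a) r| ≤ C := by
  have hc : Continuous (deriv Real.smoothTransition) :=
    (Real.smoothTransition.contDiff (n := 1)).continuous_deriv le_rfl
  obtain ⟨C, hC⟩ := isCompact_Icc.exists_bound_of_continuousOn (s := Icc (0 : ℝ) 1)
    hc.continuousOn
  have hC0 : 0 ≤ C := (norm_nonneg _).trans (hC 0 (by simp))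
  refine ⟨C, hC0, fun a r => ?_⟩
  rcases lt_or_ge r a with h | h
  · rw [deriv_cutoff_of_lt h, abs_zero]; exact hC0
  rcases lt_or_ge (a + 1) r with h' | h'
  · rw [deriv_eq_zero_of_vanish (fun r hr => cutoff_of_ge hr) h', abs_zero]; exact hC0
  · have h1 : deriv (cutoff a) r = -deriv Real.smoothTransition (r - a) := by
      have : cutoff a = fun r => 1 - Real.smoothTransition (r - a) := rfl
      rw [this, deriv_const_sub, deriv_comp_sub_const]
    rw [h1, abs_neg]
    exact hC _ ⟨by linarith, by linarith⟩

/-- The weak derivative of `χ u` is approximated in `L²(r dr)` by a continuous function, which is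
then integrated back from infinity to a `C¹` function. The Hardy inequality transfers the error to
the function itself, and multiplication by `r - τ` is bounded on the common support. -/
lemma cutoff_mem_closure_radialCore {u g : L2r} (hug : IsWeakDeriv u g) (τ : ℝ) {χ : ℝ → ℝ}
    (hχ : ContDiff ℝ ∞ χ) {M : ℝ} (hM0 : 0 ≤ M) (hM : ∀ r, M ≤ r → χ r = 0)
    {z : L2r × L2r × L2r} (h1 : z.1 =ᵐ[radialMeasure] fun r => (χ r : ℂ) * u r)
    (h2 : z.2.1 =ᵐ[radialMeasure] fun r => (χ r : ℂ) * g r + ((deriv χ r : ℝ) : ℂ) * u r)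
    (h3 : z.2.2 =ᵐ[radialMeasure] fun r => ((r - τ : ℝ) : ℂ) * z.1 r) :
    z ∈ closure (radialCore τ) := by
  rw [Metric.mem_closure_iff]
  intro ε hε
  set G : ℝ → ℂ := fun r => (χ r : ℂ) * g r + ((deriv χ r : ℝ) : ℂ) * u r with hG
  -- The three errors are at most `(M + 1) η`, `η` and `(M + 1 + |τ|) (M + 1) η`. This `C` dominates
  -- all three factors.
  set C : ℝ := (M + 1 + |τ| + 1) * (M + 1) with hC
  have hC1 : M + 1 ≤ C := by nlinarith [abs_nonneg τ]
  have hC2 : 1 ≤ C := by linarith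
  set η : ℝ := ε / (2 * C) with hη
  have hη0 : 0 < η := by positivity
  have hηC : C * η < ε := by
    rw [hη]
    field_simp
    linarith
  obtain ⟨k, hkc, hkη, hk, -⟩ := (Lp.memLp z.2.1).exists_hasCompactSupport_eLpNorm_sub_le
    ENNReal.ofNat_ne_top (ε := ENNReal.ofReal η) (by simpa using hη0)
  -- The support of `k` is not controlled. As `G` vanishes beyond `M`, multiplying `k` by a cut-off
  -- equal to `1` up to `M` does not increase the error.
  set k' : ℝ → ℂ := fun r => (cutoff M r : ℂ) * k r with hk'
  have ck' : Continuous k' :=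
    (Complex.continuous_ofReal.comp (contDiff_cutoff M).continuous).mul hk
  have ik' : Integrable k' := ck'.integrable_of_hasCompactSupport hkc.mul_left
  have hk'0 : ∀ r, M + 1 ≤ r → k' r = 0 := fun r hr => by simp [hk', cutoff_of_ge hr]
  have hG0 : ∀ r, M < r → G r = 0 := fun r hr => by
    simp [hG, hM r hr.le, deriv_eq_zero_of_vanish hM hr]
  set f : ℝ → ℂ := fun s => -∫ t in Ioi s, k' t with hf
  have hfd : ∀ r, HasDerivAt f (k' r) r := hasDerivAt_neg_integral_Ioi ck' ik'
  have hfd' : deriv f = k' := funext fun r => (hfd r).deriv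
  have hfC : ContDiff ℝ 1 f := by
    rw [contDiff_one_iff_deriv, hfd']
    exact ⟨fun r => (hfd r).differentiableAt, ck'⟩
  have hf0 : ∀ r, M + 1 ≤ r → f r = 0 := fun r hr => by
    rw [hf]
    simp only [neg_eq_zero]
    exact setIntegral_eq_zero_of_forall_eq_zero fun s hs => hk'0 s (hr.trans (le_of_lt hs))
  have mf := memLp_radial_of_continuous hfC.continuous hf0
  have mk := memLp_radial_of_continuous ck' hk'0
  have mτ : MemLp (fun r => ((r - τ : ℝ) : ℂ) * f r) 2 radialMeasure :=
    memLp_radial_of_continuous ((Complex.continuous_ofReal.comp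
      (continuous_id.sub continuous_const)).mul hfC.continuous) (M := M + 1)
      fun r hr => by simp [hf0 r hr]
  have e2 : eLpNorm (k' - G) 2 radialMeasure ≤ ENNReal.ofReal η := by
    refine (eLpNorm_mono_ae ?_).trans hkη
    filter_upwards [h2] with r hr
    rw [Pi.sub_apply, Pi.sub_apply, hr, norm_sub_rev]
    rcases le_or_gt r M with h | h
    · simp [hk', cutoff_of_le h]
    · change ‖G r - k' r‖ ≤ ‖G r - k r‖
      rw [hG0 r h, zero_sub, zero_sub, norm_neg, norm_neg, hk', norm_mul]
      have := abs_cutoff_le M r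
      simp only [Complex.norm_real, Real.norm_eq_abs]
      nlinarith [norm_nonneg (k r)]
  have e1 : eLpNorm (⇑z.1 - f) 2 radialMeasure ≤ ENNReal.ofReal (M + 1) * ENNReal.ofReal η := by
    have hae : (⇑z.1 - f) =ᵐ[radialMeasure] fun s => ∫ r in Ioi s, (k' - G) r := by
      have hpos : ∀ᵐ r ∂radialMeasure, 0 < r :=
        ae_radialMeasure_iff.2 (ae_restrict_mem measurableSet_Ioi)
      filter_upwards [h1, cutoff_eq_primitive hug hχ hM, hpos] with r hr1 hr2 hr0
      rw [Pi.sub_apply, hr1, hr2]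
      simp only [Pi.sub_apply]
      rw [integral_sub ik'.integrableOn (integrableOn_cutoff_deriv u g hχ hM hr0), hf]
      ring
    rw [eLpNorm_congr_ae hae]
    refine (eLpNorm_primitive_le ?_ (M := M + 1) fun r hr => ?_).trans (by gcongr)
    · refine ck'.aestronglyMeasurable.sub (AEStronglyMeasurable.add ?_ ?_)
      · exact (Complex.continuous_ofReal.comp hχ.continuous).aestronglyMeasurable.mul
          (Lp.stronglyMeasurable g).aestronglyMeasurable
      · exact (Complex.continuous_ofReal.comp
          (hχ.continuous_deriv (by simp))).aestronglyMeasurable.mul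
          (Lp.stronglyMeasurable u).aestronglyMeasurable
    · rw [Pi.sub_apply, hk'0 r hr.le, hG0 r (by linarith), sub_zero]
  have e3 : eLpNorm (⇑z.2.2 - fun r => ((r - τ : ℝ) : ℂ) * f r) 2 radialMeasure
      ≤ ENNReal.ofReal (M + 1 + |τ|) * (ENNReal.ofReal (M + 1) * ENNReal.ofReal η) := by
    refine (eLpNorm_le_mul_eLpNorm_of_ae_le_mul (g := ⇑z.1 - f) (c := M + 1 + |τ|) ?_ 2).trans
      (by gcongr)
    have hpos : ∀ᵐ r ∂radialMeasure, 0 < r :=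
      ae_radialMeasure_iff.2 (ae_restrict_mem measurableSet_Ioi)
    filter_upwards [h1, h3, hpos] with r hr1 hr3 hr0
    rw [Pi.sub_apply, Pi.sub_apply, hr3, ← mul_sub, norm_mul]
    rcases le_or_gt r (M + 1) with h | h
    · refine mul_le_mul_of_nonneg_right ?_ (norm_nonneg _)
      rw [Complex.norm_real, Real.norm_eq_abs]
      refine (abs_sub _ _).trans ?_
      rw [abs_of_pos hr0]
      linarith
    · rw [hr1, hf0 r h.le, hM r (by linarith)]
      simp
  refine ⟨(mf.toLp f, mk.toLp k', mτ.toLp _), ⟨f, hfC, ⟨M + 1, hf0⟩, mf.coeFn_toLp, ?_,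
    mτ.coeFn_toLp⟩, ?_⟩
  · rw [hfd']
    exact mk.coeFn_toLp
  · have hlt : ∀ c : ℝ, c ≤ C * η → ENNReal.ofReal c < ENNReal.ofReal ε := fun c hc =>
      (ENNReal.ofReal_lt_ofReal_iff hε).2 (hc.trans_lt hηC)
    rw [← edist_lt_ofReal, Prod.edist_eq, Prod.edist_eq]
    refine max_lt ?_ (max_lt ?_ ?_)
    · rw [Lp.edist_def, eLpNorm_congr_ae (Filter.EventuallyEq.rfl.sub mf.coeFn_toLp)]
      refine e1.trans_lt ?_
      rw [← ENNReal.ofReal_mul (by positivity)]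
      exact hlt _ (by gcongr)
    · rw [Lp.edist_def, eLpNorm_congr_ae (h2.sub mk.coeFn_toLp), eLpNorm_sub_comm]
      refine e2.trans_lt (hlt _ ?_)
      nlinarith
    · rw [Lp.edist_def, eLpNorm_congr_ae (Filter.EventuallyEq.rfl.sub mτ.coeFn_toLp)]
      refine e3.trans_lt ?_
      rw [← ENNReal.ofReal_mul (by positivity), ← ENNReal.ofReal_mul (by positivity)]
      refine hlt _ ?_
      rw [← mul_assoc]
      refine mul_le_mul_of_nonneg_right ?_ hη0.le
      rw [hC]
      exact mul_le_mul_of_nonneg_right (by linarith) (by linarith)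

/-- The core is dense in the form domain of the radial operator. -/
theorem mem_closure_radialCore {u g p : L2r} (hug : IsWeakDeriv u g) {τ : ℝ}
    (hp : p =ᵐ[radialMeasure] fun r => ((r - τ : ℝ) : ℂ) * u r) :
    (u, g, p) ∈ closure (radialCore τ) := by
  obtain ⟨C, hC0, hC⟩ := exists_abs_deriv_cutoff_le
  have cχ : ∀ a, Continuous fun r => (cutoff a r : ℂ) := fun a =>
    Complex.continuous_ofReal.comp (contDiff_cutoff a).continuous
  have cχ' : ∀ a, Continuous fun r => ((deriv (cutoff a) r : ℝ) : ℂ) := fun a =>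
    Complex.continuous_ofReal.comp ((contDiff_cutoff a).continuous_deriv (by simp))
  have m1 : ∀ a (v : L2r), MemLp (fun r => (cutoff a r : ℂ) * v r) 2 radialMeasure := fun a v =>
    (Lp.memLp v).of_le ((cχ a).aestronglyMeasurable.mul (Lp.aestronglyMeasurable v))
      (Filter.Eventually.of_forall fun r => by
        rw [norm_mul, Complex.norm_real, Real.norm_eq_abs]
        nlinarith [abs_cutoff_le a r, norm_nonneg (v r)])
  have m2 : ∀ a, MemLp (fun r => ((deriv (cutoff a) r : ℝ) : ℂ) * u r) 2 radialMeasure := fun a =>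
    (Lp.memLp u).of_le_mul (c := C)
      ((cχ' a).aestronglyMeasurable.mul (Lp.aestronglyMeasurable u))
      (Filter.Eventually.of_forall fun r => by
        rw [norm_mul, Complex.norm_real, Real.norm_eq_abs]
        exact mul_le_mul_of_nonneg_right (hC a r) (norm_nonneg _))
  have m3 : ∀ a, MemLp (fun r => (cutoff a r : ℂ) * g r + ((deriv (cutoff a) r : ℝ) : ℂ) * u r) 2
      radialMeasure := fun a => (m1 a g).add (m2 a)
  have hev : ∀ r : ℝ, ∀ᶠ n : ℕ in Filter.atTop, r < n := fun r =>
    (tendsto_natCast_atTop_atTop.eventually_gt_atTop r)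
  have t1 : ∀ v : L2r, Filter.Tendsto (fun n : ℕ => (m1 n v).toLp _) Filter.atTop (nhds v) := by
    intro v
    refine tendsto_L2r_of_dominated (Lp.memLp v).norm (fun n => ?_) ?_
    · filter_upwards [(m1 n v).coeFn_toLp] with r hr
      rw [hr, ← sub_one_mul, norm_mul]
      have h1 : ‖(cutoff n r : ℂ) - 1‖ ≤ 1 := by
        have := abs_cutoff_sub_one_le n r
        rwa [← Real.norm_eq_abs, ← Complex.norm_real, Complex.ofReal_sub, Complex.ofReal_one] at this
      nlinarith [norm_nonneg (v r)]
    · filter_upwards [ae_all_iff.2 fun n : ℕ => (m1 n v).coeFn_toLp] with r hr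
      filter_upwards [hev r] with n hn
      rw [hr n, cutoff_of_le hn.le, Complex.ofReal_one, one_mul]
  have t2 : Filter.Tendsto (fun n : ℕ => (m3 n).toLp _) Filter.atTop (nhds g) := by
    refine tendsto_L2r_of_dominated (b := fun r => ‖g r‖ + C * ‖u r‖)
      ((Lp.memLp g).norm.add ((Lp.memLp u).norm.const_mul C)) (fun n => ?_) ?_
    · filter_upwards [(m3 n).coeFn_toLp] with r hr
      have h1 : ‖(cutoff n r : ℂ) - 1‖ ≤ 1 := by
        have := abs_cutoff_sub_one_le n r
        rwa [← Real.norm_eq_abs, ← Complex.norm_real, Complex.ofReal_sub, Complex.ofReal_one] at this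
      have h2 : ‖((deriv (cutoff n) r : ℝ) : ℂ)‖ ≤ C := by
        rw [Complex.norm_real]
        exact hC n r
      rw [hr, show (cutoff n r : ℂ) * g r + ((deriv (cutoff n) r : ℝ) : ℂ) * u r - g r
        = ((cutoff n r : ℂ) - 1) * g r + ((deriv (cutoff n) r : ℝ) : ℂ) * u r by ring]
      refine (norm_add_le _ _).trans ?_
      rw [norm_mul, norm_mul]
      have h3 := mul_le_mul_of_nonneg_right h1 (norm_nonneg (g r))
      have h4 := mul_le_mul_of_nonneg_right h2 (norm_nonneg (u r))
      linarith
    · filter_upwards [ae_all_iff.2 fun n : ℕ => (m3 n).coeFn_toLp] with r hr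
      filter_upwards [hev r] with n hn
      rw [hr n, cutoff_of_le hn.le, deriv_cutoff_of_lt hn, Complex.ofReal_one, one_mul,
        Complex.ofReal_zero, zero_mul, add_zero]
  refine isClosed_closure.mem_of_tendsto ((t1 u).prodMk_nhds (t2.prodMk_nhds (t1 p)))
    (Filter.Eventually.of_forall fun n => ?_)
  refine cutoff_mem_closure_radialCore hug τ (contDiff_cutoff n) (M := n + 1) (by positivity)
    (fun r hr => cutoff_of_ge hr) (m1 n u).coeFn_toLp (m3 n).coeFn_toLp ?_
  filter_upwards [(m1 n u).coeFn_toLp, (m1 n p).coeFn_toLp, hp] with r h1 h2 h3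
  rw [h1, h2, h3]
  ring

/-! ### From radial eigenvalues to the bound on the wedge -/

lemma norm_sq_eq_of_isEigenvalue {H K : Type*} [NormedAddCommGroup H] [InnerProductSpace ℂ H]
    [NormedAddCommGroup K] [InnerProductSpace ℂ K] {D : H → K → Prop} {t : ℝ}
    (h : IsEigenvalue (FormOperator D) t) :
    ∃ u w, u ≠ 0 ∧ D u w ∧ ‖w‖ ^ 2 = t * ‖u‖ ^ 2 := by
  obtain ⟨u, hu, w, hw, h⟩ := h
  refine ⟨u, w, hu, hw, ?_⟩
  have h1 := h u w hw
  rw [inner_smul_right, inner_self_eq_norm_sq_to_K, inner_self_eq_norm_sq_to_K] at h1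
  have h2 : ((‖w‖ ^ 2 : ℝ) : ℂ) = ((t * ‖u‖ ^ 2 : ℝ) : ℂ) := by
    push_cast
    exact h1
  exact Complex.ofReal_injective h2

lemma eigenvalue_nonneg {H K : Type*} [NormedAddCommGroup H] [InnerProductSpace ℂ H]
    [NormedAddCommGroup K] [InnerProductSpace ℂ K] {D : H → K → Prop} {t : ℝ}
    (h : IsEigenvalue (FormOperator D) t) : 0 ≤ t := by
  obtain ⟨u, w, hu, -, h⟩ := norm_sq_eq_of_isEigenvalue h
  have : 0 < ‖u‖ := norm_pos_iff.2 hu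
  by_contra! hneg
  nlinarith [sq_nonneg ‖w‖, mul_pos this this]

/-- Eigenvalues of the radial operator are approximated by Rayleigh quotients of real `C¹`
functions vanishing for large `r`. -/
theorem exists_radial_trial_of_isEigenvalue {τ t : ℝ} (h : IsEigenvalue (RadialOperator τ) t)
    {ε : ℝ} (hε : 0 < ε) :
    ∃ f : ℝ → ℝ, ContDiff ℝ 1 f ∧ (∃ M, ∀ r, M ≤ r → f r = 0) ∧
      (0 < ∫ r in Ioi (0 : ℝ), f r ^ 2 * r) ∧
      ∫ r in Ioi (0 : ℝ), (deriv f r ^ 2 + (r - τ) ^ 2 * f r ^ 2) * r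
        < (t + ε) * ∫ r in Ioi (0 : ℝ), f r ^ 2 * r := by
  have ht := eigenvalue_nonneg h
  obtain ⟨u, w, hu, ⟨hug, hp⟩, hw⟩ := norm_sq_eq_of_isEigenvalue h
  rw [PiLp.norm_sq_eq_of_L2, Fin.sum_univ_two] at hw
  have hmem := mem_closure_radialCore hug hp
  -- A Rayleigh quotient below `t + ε` is an open condition on the triple. It holds at the
  -- eigenfunction, hence at some element of the dense core.
  have hopen : IsOpen {z : L2r × L2r × L2r |
      ‖z.2.1‖ ^ 2 + ‖z.2.2‖ ^ 2 < (t + ε) * ‖z.1‖ ^ 2} :=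
    isOpen_lt (by fun_prop) (by fun_prop)
  have hu0 : 0 < ‖u‖ := norm_pos_iff.2 hu
  obtain ⟨z, hz, f, hf, ⟨M, hM⟩, h1, h2, h3⟩ := mem_closure_iff.1 hmem _ hopen (by
    change ‖w 0‖ ^ 2 + ‖w 1‖ ^ 2 < (t + ε) * ‖u‖ ^ 2
    rw [hw]
    nlinarith [mul_pos hε (mul_pos hu0 hu0)])
  have hz' : ‖z.2.1‖ ^ 2 + ‖z.2.2‖ ^ 2 < (t + ε) * ‖z.1‖ ^ 2 := hz
  rw [norm_sq_eq_integral_Ioi h1, norm_sq_eq_integral_Ioi h2, norm_sq_eq_integral_Ioi h3] at hz'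
  have hd : ∀ r, HasDerivAt f (deriv f r) r := fun r =>
    (hf.differentiable one_ne_zero r).hasDerivAt
  have ha : ContDiff ℝ 1 fun r => (f r).re := Complex.reCLM.contDiff.comp hf
  have hb : ContDiff ℝ 1 fun r => (f r).im := Complex.imCLM.contDiff.comp hf
  have hda : ∀ r, deriv (fun r => (f r).re) r = (deriv f r).re := fun r =>
    (Complex.reCLM.hasFDerivAt.comp_hasDerivAt r (hd r)).deriv
  have hdb : ∀ r, deriv (fun r => (f r).im) r = (deriv f r).im := fun r =>
    (Complex.imCLM.hasFDerivAt.comp_hasDerivAt r (hd r)).deriv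
  have hM1 : ∀ r, M + 1 ≤ r → f r = 0 := fun r hr => hM r (by linarith)
  have hM2 : ∀ r, M + 1 ≤ r → deriv f r = 0 := fun r hr => by
    have : f =ᶠ[nhds r] fun _ => 0 := by
      filter_upwards [lt_mem_nhds (show M < r by linarith)] with y hy using hM y hy.le
    rw [this.deriv_eq, deriv_const]
  have cf := hf.continuous
  have cf' := hf.continuous_deriv le_rfl
  have iNa : IntegrableOn (fun r => (f r).re ^ 2 * r) (Ioi 0) :=
    integrableOn_Ioi_of_continuous (M := M + 1) (by fun_prop) fun r hr => by simp [hM1 r hr]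
  have iNb : IntegrableOn (fun r => (f r).im ^ 2 * r) (Ioi 0) :=
    integrableOn_Ioi_of_continuous (M := M + 1) (by fun_prop) fun r hr => by simp [hM1 r hr]
  have iQa : IntegrableOn (fun r => ((deriv f r).re ^ 2 + (r - τ) ^ 2 * (f r).re ^ 2) * r)
      (Ioi 0) := integrableOn_Ioi_of_continuous (M := M + 1) (by fun_prop)
        fun r hr => by simp [hM1 r hr, hM2 r hr]
  have iQb : IntegrableOn (fun r => ((deriv f r).im ^ 2 + (r - τ) ^ 2 * (f r).im ^ 2) * r)
      (Ioi 0) := integrableOn_Ioi_of_continuous (M := M + 1) (by fun_prop)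
        fun r hr => by simp [hM1 r hr, hM2 r hr]
  have iD : IntegrableOn (fun r => ‖deriv f r‖ ^ 2 * r) (Ioi 0) :=
    integrableOn_Ioi_of_continuous (M := M + 1) (by fun_prop) fun r hr => by simp [hM2 r hr]
  have iP : IntegrableOn (fun r => ‖((r - τ : ℝ) : ℂ) * f r‖ ^ 2 * r) (Ioi 0) :=
    integrableOn_Ioi_of_continuous (M := M + 1) (by fun_prop) fun r hr => by simp [hM1 r hr]
  have hns : ∀ x : ℂ, ‖x‖ ^ 2 = x.re ^ 2 + x.im ^ 2 := fun x => by
    rw [← Complex.normSq_eq_norm_sq, Complex.normSq_apply]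
    ring
  have eN : ∫ r in Ioi (0 : ℝ), ‖f r‖ ^ 2 * r
      = (∫ r in Ioi (0 : ℝ), (f r).re ^ 2 * r) + ∫ r in Ioi (0 : ℝ), (f r).im ^ 2 * r := by
    rw [← integral_add iNa iNb]
    simp_rw [hns, add_mul]
  have eQ : (∫ r in Ioi (0 : ℝ), ‖deriv f r‖ ^ 2 * r)
      + ∫ r in Ioi (0 : ℝ), ‖((r - τ : ℝ) : ℂ) * f r‖ ^ 2 * r
      = (∫ r in Ioi (0 : ℝ), ((deriv f r).re ^ 2 + (r - τ) ^ 2 * (f r).re ^ 2) * r)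
        + ∫ r in Ioi (0 : ℝ), ((deriv f r).im ^ 2 + (r - τ) ^ 2 * (f r).im ^ 2) * r := by
    rw [← integral_add iD iP, ← integral_add iQa iQb]
    refine integral_congr_ae (Filter.Eventually.of_forall fun r => ?_)
    simp only [norm_mul, mul_pow, hns, Complex.norm_real, Real.norm_eq_abs, sq_abs]
    ring
  rw [eN, eQ] at hz'
  have hnn : ∀ F : ℝ → ℝ, (∀ r, 0 ≤ F r) → 0 ≤ ∫ r in Ioi (0 : ℝ), F r * r := fun F hF =>
    setIntegral_nonneg measurableSet_Ioi fun r hr => mul_nonneg (hF r) (le_of_lt hr)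
  -- Norm and energy are both sums over real and imaginary part, so at least one of the two
  -- satisfies the strict inequality.
  by_cases hcase : ∫ r in Ioi (0 : ℝ), ((deriv f r).re ^ 2 + (r - τ) ^ 2 * (f r).re ^ 2) * r
      < (t + ε) * ∫ r in Ioi (0 : ℝ), (f r).re ^ 2 * r
  · refine ⟨fun r => (f r).re, ha, ⟨M, fun r hr => by simp [hM r hr]⟩, ?_, ?_⟩
    · have := (hnn _ fun r => by positivity).trans_lt hcase
      exact pos_of_mul_pos_right this (by linarith)
    · simpa only [hda] using hcase
  · have hcase' : ∫ r in Ioi (0 : ℝ), ((deriv f r).im ^ 2 + (r - τ) ^ 2 * (f r).im ^ 2) * r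
      < (t + ε) * ∫ r in Ioi (0 : ℝ), (f r).im ^ 2 * r := by
      linarith
    refine ⟨fun r => (f r).im, hb, ⟨M, fun r hr => by simp [hM r hr]⟩, ?_, ?_⟩
    · have := (hnn _ fun r => by positivity).trans_lt hcase'
      exact pos_of_mul_pos_right this (by linarith)
    · simpa only [hdb] using hcase'

lemma zeta_nonneg (τ : ℝ) : 0 ≤ zeta τ :=
  le_iInf₂ fun _ ht => by exact_mod_cast eigenvalue_nonneg ht

lemma Xi0_nonneg : 0 ≤ Xi0 := le_iInf zeta_nonneg

/-- To bound an extended real by an affine function of `Ξ₀` it suffices to do so for all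
eigenvalues. -/
lemma le_mul_Xi0_add {E : EReal} {b c : ℝ} (hb : 0 < b)
    (h : ∀ τ t, IsEigenvalue (RadialOperator τ) t → E ≤ ((b * t + c : ℝ) : EReal)) :
    E ≤ (b : EReal) * Xi0 + (c : EReal) := by
  rcases eq_or_ne Xi0 ⊤ with htop | htop
  · rw [htop, EReal.coe_mul_top_of_pos hb, EReal.top_add_coe]
    exact le_top
  · have hbot : Xi0 ≠ ⊥ := fun hb => by
      have := Xi0_nonneg
      rw [hb] at this
      exact absurd this (by simp)
    lift Xi0 to ℝ using ⟨htop, hbot⟩ with x hx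
    rw [← EReal.coe_mul, ← EReal.coe_add]
    refine EReal.le_of_forall_lt_iff_le.1 fun z hz => ?_
    rw [EReal.coe_lt_coe_iff] at hz
    have hlt : Xi0 < (((z - c) / b : ℝ) : EReal) := by
      rw [← hx, EReal.coe_lt_coe_iff, lt_div_iff₀ hb]
      linarith
    obtain ⟨τ, hτ⟩ := iInf_lt_iff.1 hlt
    obtain ⟨t, ht⟩ := iInf_lt_iff.1 hτ
    obtain ⟨hev, ht⟩ := iInf_lt_iff.1 ht
    refine (h τ t hev).trans ?_
    rw [EReal.coe_lt_coe_iff, lt_div_iff₀ hb] at ht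
    rw [EReal.coe_le_coe_iff]
    linarith

/-- The bound on the ground energy of small wedges by an eigenvalue of the radial operator, with a
constant that is uniform in the eigenvalue. -/
theorem groundEnergy_le_eigenvalue (B : E3) (hB2 : 0 < B 1) :
    ∃ C : ℝ, 0 < C ∧ ∀ A : E3 →L[ℝ] E3, (∀ x, curl A x = B) → ∀ α, 0 < α → α ≤ 2 →
      ∀ τ t, IsEigenvalue (RadialOperator τ) t →
        groundEnergy A α ≤ ((B 1 * t + C * α ^ 2 : ℝ) : EReal) := by
  obtain ⟨f₀, hf₀, hM₀, hN₀, hQ₀⟩ := exists_radial_trial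
  set D := (B 0 ^ 2 + B 2 ^ 2) / (3 * B 1) with hD
  have hD0 : 0 ≤ D := by positivity
  set κ := (∫ r in Ioi (0 : ℝ), f₀ r ^ 2 * r ^ 3) / ∫ r in Ioi (0 : ℝ), f₀ r ^ 2 * r with hκ
  have hκ0 : 0 ≤ κ := div_nonneg (setIntegral_nonneg measurableSet_Ioi fun r hr => by
    have : 0 < r := hr
    positivity) hN₀.le
  -- `κ` is the moment of the explicit trial function and `2000` bounds that of every low-energy
  -- one. The summand `1` keeps the constant positive when `B 0 = B 2 = 0`.
  refine ⟨D * (κ + 2000) + 1, by positivity, fun A hA α hα hα2 τ t ht => ?_⟩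
  have htan : 0 < Real.tan (α / 2) :=
    Real.tan_pos_of_pos_of_lt_pi_div_two (by linarith) (by linarith [Real.pi_gt_three])
  have htan2 : Real.tan (α / 2) ^ 2 ≤ α ^ 2 := by
    have := tan_half_le hα hα2
    gcongr
  have hform : ∀ x : ℝ, 0 ≤ x → x ≤ κ + 2000 →
      (B 0 ^ 2 + B 2 ^ 2) * Real.tan (α / 2) ^ 2 / (3 * B 1) * x
        ≤ (D * (κ + 2000) + 1) * α ^ 2 := fun x hx0 hx => by
    have h1 : (B 0 ^ 2 + B 2 ^ 2) * Real.tan (α / 2) ^ 2 / (3 * B 1) * x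
        = D * x * Real.tan (α / 2) ^ 2 := by rw [hD]; ring
    rw [h1]
    have h2 : D * x ≤ D * (κ + 2000) := by gcongr
    refine mul_le_mul (by linarith) htan2 (by positivity) (by positivity)
  -- Above the threshold the explicit trial function already does at least as well as the
  -- eigenvalue. Below it the energy is low enough for the uniform moment bound.
  rcases le_or_gt (23 / 25) t with hcase | hcase
  · refine (groundEnergy_le_radial hA hB2 htan (3 / 2) hf₀ hM₀ hN₀).trans ?_
    rw [EReal.coe_le_coe_iff]
    refine add_le_add (mul_le_mul_of_nonneg_left ?_ hB2.le) (hform κ hκ0 (by linarith))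
    rw [div_le_iff₀ hN₀]
    nlinarith
  · refine EReal.le_of_forall_lt_iff_le.1 fun z hz => ?_
    rw [EReal.coe_lt_coe_iff] at hz
    set C := D * (κ + 2000) + 1
    -- Besides fitting into the slack, `ε` must keep `t + ε` at or below `23 / 25` for the moment
    -- bound to apply.
    obtain ⟨ε, hε, hε1, hε2⟩ : ∃ ε > 0, B 1 * ε ≤ z - (B 1 * t + C * α ^ 2) ∧ t + ε ≤ 23 / 25 := by
      refine ⟨min ((z - (B 1 * t + C * α ^ 2)) / B 1) (23 / 25 - t),
        lt_min (div_pos (by linarith) hB2) (by linarith), ?_, ?_⟩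
      · rw [← le_div_iff₀' hB2]
        exact min_le_left _ _
      · linarith [min_le_right ((z - (B 1 * t + C * α ^ 2)) / B 1) (23 / 25 - t)]
    obtain ⟨f, hf, ⟨M, hM⟩, hN, hQ⟩ := exists_radial_trial_of_isEigenvalue ht hε
    have hP := radial_moment_le hf hM hN (hQ.trans_le (mul_le_mul_of_nonneg_right hε2 hN.le))
    refine (groundEnergy_le_radial hA hB2 htan τ hf hM hN).trans ?_
    rw [EReal.coe_le_coe_iff]
    have h1 : (∫ r in Ioi (0 : ℝ), (deriv f r ^ 2 + (r - τ) ^ 2 * f r ^ 2) * r)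
        / ∫ r in Ioi (0 : ℝ), f r ^ 2 * r ≤ t + ε := by
      rw [div_le_iff₀ hN]
      exact hQ.le
    have h2 := hform ((∫ r in Ioi (0 : ℝ), f r ^ 2 * r ^ 3) / ∫ r in Ioi (0 : ℝ), f r ^ 2 * r)
      (div_nonneg (setIntegral_nonneg measurableSet_Ioi fun r hr => by
        have : 0 < r := hr
        positivity) hN.le) (by
        rw [div_le_iff₀ hN]
        nlinarith)
    have h3 := mul_le_mul_of_nonneg_left h1 hB2.le
    linarith

end WedgeMagnetic

end

theorem proposition5p2 (B : WedgeMagnetic.E3) (hB : ‖B‖ = 1) (hB2 : 0 < B 1) :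
    ∃ C : ℝ, 0 < C ∧
      ∀ A : WedgeMagnetic.E3 →L[ℝ] WedgeMagnetic.E3, (∀ x, WedgeMagnetic.curl A x = B) →
        ∀ α ∈ Set.Ioo (0 : ℝ) Real.pi,
          WedgeMagnetic.groundEnergy A α
            ≤ ((B 1 : ℝ) : EReal) * WedgeMagnetic.Xi0 + ((C * α ^ 2 : ℝ) : EReal) := by
  obtain ⟨C₁, hC₁, h₁⟩ := WedgeMagnetic.groundEnergy_le_eigenvalue B hB2
  obtain ⟨C₂, h₂⟩ := WedgeMagnetic.exists_groundEnergy_le_of_two_le B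
  refine ⟨C₁ + |C₂|, by positivity, fun A hA α hα => ?_⟩
  refine WedgeMagnetic.le_mul_Xi0_add hB2 fun τ t ht => ?_
  rcases le_total α 2 with h | h
  · refine (h₁ A hA α hα.1 h τ t ht).trans ?_
    rw [EReal.coe_le_coe_iff]
    have : 0 ≤ |C₂| * α ^ 2 := by positivity
    nlinarith
  -- Here `α ^ 2 ≥ 1`, so the constant bound is absorbed by `|C₂| * α ^ 2`. The term `B 1 * t` is
  -- nonnegative and can be added.
  · refine (h₂ A hA α h hα.2).trans ?_
    rw [EReal.coe_le_coe_iff]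
    have h3 : 0 ≤ B 1 * t := mul_nonneg hB2.le (WedgeMagnetic.eigenvalue_nonneg ht)
    have h4 : |C₂| * 1 ≤ |C₂| * α ^ 2 := by gcongr; nlinarith
    have h5 : 0 ≤ C₁ * α ^ 2 := by positivity
    have h6 := le_abs_self C₂
    nlinarith
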